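/- Let $n>3$ and let $(M,g)$ be a smooth Riemannian $n$-manifold of positive sectional curvature, with Levi-Civita connection $\nabla$ and curvature tensor $R_{abcd}$, with the sign convention that $R_{abab}>0$ on round spheres. Say that a smooth symmetric $(0,2)$-tensor field $\Pi$ on $M$ satisfies the Gauss equation if $R_{abcd}=\Pi_{ac}\Pi_{bd}-\Pi_{ad}\Pi_{bc}$, and the Codazzi equation if $\Pi_{a[b;c]}=0$, i.e. $\Pi_{ab;c}=\Pi_{ac;b}$. (1) Suppose that the curvature operator $\omega_{ab}\mapsto\frac12 R_{ab}{}^{cd}\omega_{cd}$ on $2$-forms is positive definite at every point, so that its logarithm is defined; let $R^*_{abcd}$ be the $(0,4)$-tensor field whose operator on $2$-forms, $\omega_{ab}\mapsto\frac12 R^*_{ab}{}^{cd}\omega_{cd}$, is this logarithm. Put $R^*_{bd}=g^{ac}R^*_{abcd}$ and let $s^*=g^{bd}R^*_{bd}$ be its trace, and let $$P^*_{ab}=\frac1{n-2}\Big(R^*_{ab}-\frac{s^*}{2(n-1)}g_{ab}\Big),\qquad C^*_{abcd}=R^*_{abcd}-\big(g_{ac}P^*_{bd}+P^*_{ac}g_{bd}-P^*_{ad}g_{bc}-g_{ad}P^*_{bc}\big)$$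 be its Schouten and Weyl components. If $C^*=0$ on $M$, then $\Pi=e^{P^*}$ (the exponential of the endomorphism $P^*_a{}^b$, with the index lowered again) is a smooth symmetric tensor field that satisfies the Gauss equation and the Codazzi equation. (2) Every smooth symmetric $(0,2)$-tensor field $\Pi$ on $M$ that satisfies the Gauss equation also satisfies the Codazzi equation. -/

import Mathlib

open Bundle FiberBundle VectorField Module
open scoped Manifold ContDiff InnerProductSpace

noncomputable section

namespace Hypersurface

section Pointwise

variable {V : Type*} [NormedAddCommGroup V] [InnerProductSpace ℝ V] [FiniteDimensional ℝ V]

/-- Index set of the basis `e i ∧ e j`, `i < j`, of the second exterior power of `V`, where `e` is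
an orthonormal basis of `V`. -/
abbrev PairIndex (V : Type*) [NormedAddCommGroup V] [InnerProductSpace ℝ V] : Type :=
  {p : Fin (finrank ℝ V) × Fin (finrank ℝ V) // p.1 < p.2}

/-- The coordinates of `a ∧ b` in the basis `e i ∧ e j`, `i < j`. -/
def wedgeCoord (a b : V) (p : PairIndex V) : ℝ :=
  ⟪stdOrthonormalBasis ℝ V p.1.1, a⟫_ℝ * ⟪stdOrthonormalBasis ℝ V p.1.2, b⟫_ℝ
    - ⟪stdOrthonormalBasis ℝ V p.1.2, a⟫_ℝ * ⟪stdOrthonormalBasis ℝ V p.1.1, b⟫_ℝ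

/-- The operator on `2`-forms defined by a covariant `4`-tensor `R` with the symmetries of a
curvature tensor, `ω ↦ (1 / 2) ∑ c d, R a b c d * ω c d = ∑ c < d, R a b c d * ω c d`,
as a matrix in the orthonormal basis `e i ∧ e j`, `i < j`. -/
def operatorMatrix (R : V → V → V → V → ℝ) : Matrix (PairIndex V) (PairIndex V) ℝ :=
  Matrix.of fun p q ↦ R (stdOrthonormalBasis ℝ V p.1.1) (stdOrthonormalBasis ℝ V p.1.2)
    (stdOrthonormalBasis ℝ V q.1.1) (stdOrthonormalBasis ℝ V q.1.2)

/-- The covariant `4`-tensor `R*` whose operator on `2`-forms is the logarithm (in the sense of the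
functional calculus of symmetric operators) of the operator of `R`. It is meant for `R` with
positive definite operator. -/
def logTensor (R : V → V → V → V → ℝ) (a b c d : V) : ℝ :=
  wedgeCoord a b ⬝ᵥ (cfc Real.log (operatorMatrix R)).mulVec (wedgeCoord c d)

/-- The Ricci contraction, trace over the first and third slots. -/
def ricci (R : V → V → V → V → ℝ) (b d : V) : ℝ :=
  ∑ i, R (stdOrthonormalBasis ℝ V i) b (stdOrthonormalBasis ℝ V i) d

/-- The full contraction. -/
def scalar (R : V → V → V → V → ℝ) : ℝ :=
  ∑ i, ricci R (stdOrthonormalBasis ℝ V i) (stdOrthonormalBasis ℝ V i)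

/-- The Schouten component. -/
def schouten (R : V → V → V → V → ℝ) (a b : V) : ℝ :=
  1 / ((finrank ℝ V : ℝ) - 2) *
    (ricci R a b - scalar R / (2 * ((finrank ℝ V : ℝ) - 1)) * ⟪a, b⟫_ℝ)

/-- The Weyl component. -/
def weyl (R : V → V → V → V → ℝ) (a b c d : V) : ℝ :=
  R a b c d - (⟪a, c⟫_ℝ * schouten R b d + schouten R a c * ⟪b, d⟫_ℝ
    - schouten R a d * ⟪b, c⟫_ℝ - ⟪a, d⟫_ℝ * schouten R b c)

/-- The bilinear form `e^B`: the exponential of the operator obtained from `B` by raising an index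
with the inner product, lowered again. -/
def expForm (B : V → V → ℝ) : V →L[ℝ] V →L[ℝ] ℝ :=
  ∑ i, ∑ j, NormedSpace.exp (Matrix.of fun k l ↦
      B (stdOrthonormalBasis ℝ V k) (stdOrthonormalBasis ℝ V l)) i j •
    (innerSL ℝ (stdOrthonormalBasis ℝ V i)).smulRight (innerSL ℝ (stdOrthonormalBasis ℝ V j))

end Pointwise

section Connection

variable {E : Type*} [NormedAddCommGroup E] [NormedSpace ℝ E] [FiniteDimensional ℝ E]
  {H : Type*} [TopologicalSpace H] (I : ModelWithCorners ℝ E H)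
  {M : Type*} [TopologicalSpace M] [ChartedSpace H M] [IsManifold I ∞ M]
  [RiemannianBundle (fun x : M ↦ TangentSpace I x)]

/-- The Koszul expression for `2 ⟪∇_X Y, Z⟫`. -/
def koszul (Y X Z : Π x : M, TangentSpace I x) (x : M) : ℝ :=
  mvfderiv I (fun y ↦ ⟪Y y, Z y⟫_ℝ) x (X x) + mvfderiv I (fun y ↦ ⟪Z y, X y⟫_ℝ) x (Y x)
    - mvfderiv I (fun y ↦ ⟪X y, Y y⟫_ℝ) x (Z x)
    + ⟪mlieBracket I X Y x, Z x⟫_ℝ - ⟪mlieBracket I Y Z x, X x⟫_ℝ + ⟪mlieBracket I Z X x, Y x⟫_ℝ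

variable [IsContMDiffRiemannianBundle I ∞ E (fun x : M ↦ TangentSpace I x)]

theorem mdiffAt_inner {X Y : Π x : M, TangentSpace I x} {x : M}
    (hX : MDiffAt (T% X) x) (hY : MDiffAt (T% Y) x) : MDiffAt (fun y ↦ ⟪X y, Y y⟫_ℝ) x :=
  MDifferentiableAt.inner_bundle (E := fun x : M ↦ TangentSpace I x) (IB := I) (F := E)
    (b := id) hX hY

theorem koszul_tensorial_right {Y X : Π x : M, TangentSpace I x} {x : M}
    (hY : MDiffAt (T% Y) x) (hX : MDiffAt (T% X) x) :
    TensorialAt I E (fun Z ↦ koszul I Y X Z x) x where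
  smul {f Z} hf hZ := by
    have h1 : (fun y ↦ ⟪Y y, (f • Z) y⟫_ℝ) = f * fun y ↦ ⟪Y y, Z y⟫_ℝ := by
      ext y; simp [inner_smul_right]
    have h2 : (fun y ↦ ⟪(f • Z) y, X y⟫_ℝ) = f * fun y ↦ ⟪Z y, X y⟫_ℝ := by
      ext y; simp [inner_smul_left]
    simp only [koszul, h1, h2, mvfderiv_mul hf (mdiffAt_inner I hY hZ),
      mvfderiv_mul hf (mdiffAt_inner I hZ hX), mlieBracket_smul_right hf hZ,
      mlieBracket_smul_left hf hZ]
    simp [inner_add_left, inner_smul_left, inner_smul_right, real_inner_comm]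
    ring
  add {Z Z'} hZ hZ' := by
    have h1 : (fun y ↦ ⟪Y y, (Z + Z') y⟫_ℝ) = (fun y ↦ ⟪Y y, Z y⟫_ℝ) + fun y ↦ ⟪Y y, Z' y⟫_ℝ := by
      ext y; simp [inner_add_right]
    have h2 : (fun y ↦ ⟪(Z + Z') y, X y⟫_ℝ) = (fun y ↦ ⟪Z y, X y⟫_ℝ) + fun y ↦ ⟪Z' y, X y⟫_ℝ := by
      ext y; simp [inner_add_left]
    simp only [koszul, h1, h2, mvfderiv_add (mdiffAt_inner I hY hZ) (mdiffAt_inner I hY hZ'),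
      mvfderiv_add (mdiffAt_inner I hZ hX) (mdiffAt_inner I hZ' hX), mlieBracket_add_right hZ hZ',
      mlieBracket_add_left hZ hZ']
    simp [inner_add_left, inner_add_right]
    ring


theorem koszul_tensorial_left {Y Z : Π x : M, TangentSpace I x} {x : M}
    (hY : MDiffAt (T% Y) x) (hZ : MDiffAt (T% Z) x) :
    TensorialAt I E (fun X ↦ koszul I Y X Z x) x where
  smul {f X} hf hX := by
    have h1 : (fun y ↦ ⟪Z y, (f • X) y⟫_ℝ) = f * fun y ↦ ⟪Z y, X y⟫_ℝ := by
      ext y; simp [inner_smul_right]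
    have h2 : (fun y ↦ ⟪(f • X) y, Y y⟫_ℝ) = f * fun y ↦ ⟪X y, Y y⟫_ℝ := by
      ext y; simp [inner_smul_left]
    simp only [koszul, h1, h2, mvfderiv_mul hf (mdiffAt_inner I hZ hX),
      mvfderiv_mul hf (mdiffAt_inner I hX hY), mlieBracket_smul_right hf hX,
      mlieBracket_smul_left hf hX]
    simp [inner_add_left, inner_smul_left, inner_smul_right, real_inner_comm]
    ring
  add {X X'} hX hX' := by
    have h1 : (fun y ↦ ⟪Z y, (X + X') y⟫_ℝ) = (fun y ↦ ⟪Z y, X y⟫_ℝ) + fun y ↦ ⟪Z y, X' y⟫_ℝ := by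
      ext y; simp [inner_add_right]
    have h2 : (fun y ↦ ⟪(X + X') y, Y y⟫_ℝ) = (fun y ↦ ⟪X y, Y y⟫_ℝ) + fun y ↦ ⟪X' y, Y y⟫_ℝ := by
      ext y; simp [inner_add_left]
    simp only [koszul, h1, h2, mvfderiv_add (mdiffAt_inner I hZ hX) (mdiffAt_inner I hZ hX'),
      mvfderiv_add (mdiffAt_inner I hX hY) (mdiffAt_inner I hX' hY), mlieBracket_add_right hX hX',
      mlieBracket_add_left hX hX']
    simp [inner_add_left, inner_add_right]
    ring

instance tangentSpace_finiteDimensional (x : M) : FiniteDimensional ℝ (TangentSpace I x) :=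
  inferInstanceAs (FiniteDimensional ℝ E)

instance tangentSpace_completeSpace (x : M) : CompleteSpace (TangentSpace I x) :=
  FiniteDimensional.complete ℝ (TangentSpace I x)

/-- The bilinear form `(X, Z) ↦ 2 ⟪∇_X Y, Z⟫`. -/
def koszulForm {Y : Π x : M, TangentSpace I x} {x : M} (hY : MDiffAt (T% Y) x) :
    TangentSpace I x →L[ℝ] TangentSpace I x →L[ℝ] ℝ :=
  TensorialAt.mkHom₂ (fun X Z ↦ koszul I Y X Z x) x
    (fun _ hZ ↦ koszul_tensorial_left I hY hZ) (fun _ hX ↦ koszul_tensorial_right I hY hX)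

open Classical in
/-- `nabla I Y x u` is `∇_u Y`, determined by the Koszul formula (and `0` by convention where `Y` is
not differentiable). -/
def nabla (Y : Π x : M, TangentSpace I x) (x : M) : TangentSpace I x →L[ℝ] TangentSpace I x :=
  if hY : MDiffAt (T% Y) x then
    LinearMap.toContinuousLinearMap
      { toFun := fun u ↦
          (InnerProductSpace.toDual ℝ (TangentSpace I x)).symm ((2⁻¹ : ℝ) • koszulForm I hY u)
        map_add' := fun u v ↦ by simp
        map_smul' := fun c u ↦ by simp [smul_smul, mul_comm] }
  else 0

theorem inner_nabla {X Y Z : Π x : M, TangentSpace I x} {x : M} (hX : MDiffAt (T% X) x)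
    (hY : MDiffAt (T% Y) x) (hZ : MDiffAt (T% Z) x) :
    ⟪nabla I Y x (X x), Z x⟫_ℝ = 2⁻¹ * koszul I Y X Z x := by
  have h : koszulForm I hY (X x) (Z x) = koszul I Y X Z x := TensorialAt.mkHom₂_apply _ _ hX hZ
  simp [nabla, hY, inner_smul_left, h]

theorem nabla_ext {x : M} {A B : TangentSpace I x →L[ℝ] TangentSpace I x}
    (h : ∀ X Z : Π x : M, TangentSpace I x, MDiffAt (T% X) x → MDiffAt (T% Z) x →
      ⟪A (X x), Z x⟫_ℝ = ⟪B (X x), Z x⟫_ℝ) : A = B := by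
  ext v
  refine ext_inner_right ℝ fun w ↦ ?_
  simpa using h (extend E v) (extend E w) (mdifferentiableAt_extend ..)
    (mdifferentiableAt_extend ..)

theorem isCovariantDerivativeOn_nabla :
    IsCovariantDerivativeOn E (nabla I : (Π x : M, TangentSpace I x) → _) where
  add {Y Y' x} hY hY' _ := by
    refine nabla_ext I fun X Z hX hZ ↦ ?_
    have h1 : (fun y ↦ ⟪X y, (Y + Y') y⟫_ℝ) = (fun y ↦ ⟪X y, Y y⟫_ℝ) + fun y ↦ ⟪X y, Y' y⟫_ℝ := by
      ext y; simp [inner_add_right]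
    have h2 : (fun y ↦ ⟪(Y + Y') y, Z y⟫_ℝ) = (fun y ↦ ⟪Y y, Z y⟫_ℝ) + fun y ↦ ⟪Y' y, Z y⟫_ℝ := by
      ext y; simp [inner_add_left]
    rw [inner_nabla I hX (mdifferentiableAt_add_section hY hY') hZ, add_apply, inner_add_left,
      inner_nabla I hX hY hZ, inner_nabla I hX hY' hZ]
    simp only [koszul, h1, h2, mvfderiv_add (mdiffAt_inner I hX hY) (mdiffAt_inner I hX hY'),
      mvfderiv_add (mdiffAt_inner I hY hZ) (mdiffAt_inner I hY' hZ), mlieBracket_add_right hY hY',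
      mlieBracket_add_left hY hY']
    simp [inner_add_left, inner_add_right]
    ring
  leibniz {Y f x} hY hf _ := by
    refine nabla_ext I fun X Z hX hZ ↦ ?_
    have h1 : (fun y ↦ ⟪X y, (f • Y) y⟫_ℝ) = f * fun y ↦ ⟪X y, Y y⟫_ℝ := by
      ext y; simp [inner_smul_right]
    have h2 : (fun y ↦ ⟪(f • Y) y, Z y⟫_ℝ) = f * fun y ↦ ⟪Y y, Z y⟫_ℝ := by
      ext y; simp [inner_smul_left]
    rw [inner_nabla I hX (hf.smul_section hY) hZ, add_apply, inner_add_left,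
      smul_apply, inner_smul_left,
      inner_nabla I hX hY hZ]
    simp only [koszul, h1, h2, mvfderiv_mul hf (mdiffAt_inner I hX hY),
      mvfderiv_mul hf (mdiffAt_inner I hY hZ), mlieBracket_smul_right hf hY,
      mlieBracket_smul_left hf hY]
    simp [inner_add_left, inner_smul_left, inner_smul_right, real_inner_comm]
    ring

/-- The Levi-Civita connection of the Riemannian metric, characterized by the two theorems below. -/
def leviCivita : CovariantDerivative I E (TangentSpace I : M → Type _) where
  toFun := nabla I
  isCovariantDerivativeOnUniv := isCovariantDerivativeOn_nabla I

theorem leviCivita_torsion :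
    (leviCivita I : CovariantDerivative I E (TangentSpace I : M → Type _)).torsion = 0 := by
  rw [CovariantDerivative.torsion_eq_zero_iff]
  intro X Y x hX hY
  refine ext_inner_right ℝ fun w ↦ ?_
  obtain ⟨Z, hZ, rfl⟩ : ∃ Z : Π x : M, TangentSpace I x, MDiffAt (T% Z) x ∧ Z x = w :=
    ⟨extend E w, mdifferentiableAt_extend .., by simp⟩
  have h1 := inner_nabla I hX hY hZ
  have h2 := inner_nabla I hY hX hZ
  change ⟪nabla I Y x (X x) - nabla I X x (Y x), Z x⟫_ℝ = _
  rw [inner_sub_left, h1, h2]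
  simp only [koszul, mlieBracket_swap_apply (V := Y) (W := X),
    mlieBracket_swap_apply (V := Z) (W := Y), mlieBracket_swap_apply (V := X) (W := Z),
    real_inner_comm, inner_neg_left]
  ring

theorem leviCivita_metric :
    CovariantDerivative.IsMetricCompatible (V := fun x : M ↦ TangentSpace I x) (leviCivita I) := by
  rw [CovariantDerivative.isMetricCompatible_iff]
  intro x X Y Z hX hY hZ
  have h1 := inner_nabla I hX hY hZ
  have h2 := inner_nabla I hX hZ hY
  change _ = ⟪nabla I Y x (X x), Z x⟫_ℝ + ⟪Y x, nabla I Z x (X x)⟫_ℝ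
  rw [real_inner_comm (nabla I Z x (X x)), h1, h2]
  simp only [koszul, mlieBracket_swap_apply (V := Y) (W := X),
    mlieBracket_swap_apply (V := Z) (W := Y), mlieBracket_swap_apply (V := X) (W := Z),
    real_inner_comm, inner_neg_left]
  ring

/-- The curvature `R(X, Y) Z = ∇_X ∇_Y Z - ∇_Y ∇_X Z - ∇_[X, Y] Z` of the Levi-Civita connection. -/
def curvatureField (X Y Z : Π x : M, TangentSpace I x) (x : M) : TangentSpace I x :=
  leviCivita I (fun y ↦ leviCivita I Z y (Y y)) x (X x)
    - leviCivita I (fun y ↦ leviCivita I Z y (X y)) x (Y x)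
    - leviCivita I Z x (mlieBracket I X Y x)

/-- The covariant curvature tensor `R_{abcd} = ⟪R(c, d) b, a⟫` at `x`, computed with the extensions
of tangent vectors to vector fields that are smooth near `x`. The sign is such that `R_{abab}` is
positive on round spheres. -/
def riemann (x : M) (a b c d : TangentSpace I x) : ℝ :=
  ⟪curvatureField I (extend E c) (extend E d) (extend E b) x, a⟫_ℝ

/-- The sectional curvature of the plane spanned by `u` and `v`. -/
def sectionalCurvature (x : M) (u v : TangentSpace I x) : ℝ :=
  riemann I x u v u v / (⟪u, u⟫_ℝ * ⟪v, v⟫_ℝ - ⟪u, v⟫_ℝ ^ 2)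

variable (M) in
def PositiveSectionalCurvature : Prop :=
  ∀ (x : M) (u v : TangentSpace I x), LinearIndependent ℝ ![u, v] → 0 < sectionalCurvature I x u v

variable (M) in
/-- The curvature operator on `2`-forms is positive definite at every point. -/
def PositiveCurvatureOperator : Prop :=
  ∀ x : M, (operatorMatrix (riemann I x)).PosDef

/-- The tensor `R* = ln R`, the logarithm of the curvature operator. -/
def riemannLog (x : M) (a b c d : TangentSpace I x) : ℝ :=
  logTensor (riemann I x) a b c d

/-- The tensor field `e^{P*}`, where `P*` is the Schouten component of `R*`. -/
def expSchoutenLog (x : M) : TangentSpace I x →L[ℝ] TangentSpace I x →L[ℝ] ℝ :=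
  expForm (schouten (riemannLog I x))

/-- A smooth symmetric covariant `2`-tensor field. -/
structure IsSmoothSymmetric (h : Π x : M, TangentSpace I x →L[ℝ] TangentSpace I x →L[ℝ] ℝ) :
    Prop where
  smooth : ContMDiff I (I.prod 𝓘(ℝ, E →L[ℝ] E →L[ℝ] ℝ)) ∞
    (fun x ↦ TotalSpace.mk' (E →L[ℝ] E →L[ℝ] ℝ) x (h x))
  symm : ∀ (x : M) (u v : TangentSpace I x), h x u v = h x v u

/-- The Gauss equation `R_{abcd} = h_{ac} h_{bd} - h_{ad} h_{bc}`. -/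
def Gauss (h : Π x : M, TangentSpace I x →L[ℝ] TangentSpace I x →L[ℝ] ℝ) : Prop :=
  ∀ (x : M) (a b c d : TangentSpace I x),
    riemann I x a b c d = h x a c * h x b d - h x a d * h x b c

/-- The covariant derivative `(∇_Z h)(X, Y) = Z (h(X, Y)) - h(∇_Z X, Y) - h(X, ∇_Z Y)`. -/
def covDeriv (h : Π x : M, TangentSpace I x →L[ℝ] TangentSpace I x →L[ℝ] ℝ)
    (Z X Y : Π x : M, TangentSpace I x) (x : M) : ℝ :=
  mvfderiv I (fun y ↦ h y (X y) (Y y)) x (Z x)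
    - h x (leviCivita I X x (Z x)) (Y x) - h x (X x) (leviCivita I Y x (Z x))

/-- The Codazzi equation `h_{a[b;c]} = 0`, i.e. `(∇_Z h)(X, Y) = (∇_Y h)(X, Z)`. -/
def Codazzi (h : Π x : M, TangentSpace I x →L[ℝ] TangentSpace I x →L[ℝ] ℝ) : Prop :=
  ∀ (x : M) (X Y Z : Π x : M, TangentSpace I x),
    MDiffAt (T% X) x → MDiffAt (T% Y) x → MDiffAt (T% Z) x →
      covDeriv I h Z X Y x = covDeriv I h Y X Z x

end Connection

end Hypersurface

end

/-! # Gauss and Codazzi equations for positive curvature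

**Gauss implies Codazzi.** Let `h` be a symmetric solution of the Gauss equation, and let the
sectional curvature be positive. Differentiating the Gauss equation and inserting the result into
the second Bianchi identity gives an identity, linear in `∇h`, with five free arguments. In a basis `v`
orthogonal for `h` one has `h (v i) (v i) * h (v j) (v j) > 0` for `i ≠ j`, and the identity decouples: for
`T a b c = (∇_c h)(a, b) - (∇_b h)(a, c)`, four distinct basis indices show that `T` vanishes on
distinct indices, and the remaining components satisfy sign relations among any three indices other
than a given one, which force them to vanish (`codazzi_of_differentiated_gauss`,
`Gauss.codazzi`). The geometric input, all from the Koszul formula, is that `leviCivita` preserves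
smoothness, that the curvature is a smooth tensor with its usual symmetries, and `second_bianchi`.

**The exponential satisfies the Gauss equation.** If the Weyl part of `R* = ln R` vanishes, then
`R*` is the Kulkarni-Nomizu product of `g` with `P*`, that is, its operator on bivectors is the
derivation `u ∧ v ↦ P* u ∧ v + u ∧ P* v`. The exponential of the derivation is the second compound
`u ∧ v ↦ e^{P*} u ∧ e^{P*} v` (`exp_derivation_eq_minor`), and the exponential of `R*` is `R`. Hence
`R` and the right-hand side of the Gauss equation for `Π = e^{P*}` have the same operator on
bivectors, so they agree (`eq_minor_expForm`).

**Smoothness.** `Π` is positive definite, so it is an algebraic function of `R`: for independent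
`u, v, w`, the number `Π u u` is a `2 × 2` minor of the operator of `R` divided by the square root
of its `3 × 3` minor on the span of `u ∧ v`, `u ∧ w`, `v ∧ w`, which is the square of the Gram
determinant (`apply_self_eq_div_sqrt_spanDet`). The smoothness of `R` thus passes to `Π`
(`Gauss.isSmoothSymmetric`) without any smooth dependence theorem for matrix functions.
-/

set_option linter.unusedSectionVars false

namespace Hypersurface

open Filter Topology

/-! ### Smoothness of the Levi-Civita connection -/

section Smoothness

variable {E : Type*} [NormedAddCommGroup E] [NormedSpace ℝ E]
  {H : Type*} [TopologicalSpace H] {I : ModelWithCorners ℝ E H}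
  {M : Type*} [TopologicalSpace M] [ChartedSpace H M]

theorem contMDiffAt_mvfderiv_apply [IsManifold I ∞ M] {f : M → ℝ} {X : Π x : M, TangentSpace I x}
    {x : M} (hf : CMDiffAt ∞ f x) (hX : CMDiffAt ∞ (T% X) x) :
    CMDiffAt ∞ (fun y ↦ mvfderiv I f y (X y)) x := by
  have h := ContMDiffAt.clm_apply_of_inCoordinates (n := ∞) (b₁ := id) (b₂ := f)
    (E₁ := fun y : M ↦ TangentSpace I y) (E₂ := fun y : ℝ ↦ TangentSpace 𝓘(ℝ, ℝ) y)
    (ϕ := fun y ↦ mfderiv I 𝓘(ℝ, ℝ) f y) (v := X) (m₀ := x)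
    (hf.mfderiv_const (m := ∞) le_rfl) hX hf
  rw [contMDiffAt_totalSpace] at h
  refine h.2.congr_of_eventuallyEq (.of_forall fun y ↦ ?_)
  simp [mvfderiv]
  rfl

theorem contMDiffAt_det {ι : Type*} [Fintype ι] [DecidableEq ι] {A : M → Matrix ι ι ℝ} {x : M}
    (hA : ∀ i j, CMDiffAt ∞ (fun y ↦ A y i j) x) : CMDiffAt ∞ (fun y ↦ (A y).det) x := by
  simp only [Matrix.det_apply']
  exact ContMDiffAt.sum fun σ _ ↦ contMDiffAt_const.mul (ContMDiffAt.prod fun i _ ↦ hA _ _)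

variable [FiniteDimensional ℝ E] [IsManifold I ∞ M]

theorem contMDiffAt_mlieBracket {X Y : Π x : M, TangentSpace I x} {x : M}
    (hX : CMDiffAt ∞ (T% X) x) (hY : CMDiffAt ∞ (T% Y) x) :
    CMDiffAt ∞ (T% (mlieBracket I X Y)) x :=
  have : IsManifold I (minSmoothness ℝ 2) M :=
    .of_le (n := ∞) (by rw [minSmoothness_of_isRCLikeNormedField]; exact ENat.LEInfty.out)
  have : IsManifold I (((⊤ : ℕ∞) : WithTop ℕ∞) + 1) M := .of_le (n := ∞) (by rfl)
  ContMDiffAt.mlieBracket_vectorField (m := ⊤) (n := ⊤) hX hY (by simp)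

variable [RiemannianBundle (fun x : M ↦ TangentSpace I x)]
  [IsContMDiffRiemannianBundle I ∞ E (fun x : M ↦ TangentSpace I x)]

theorem contMDiffAt_inner {X Y : Π x : M, TangentSpace I x} {x : M}
    (hX : CMDiffAt ∞ (T% X) x) (hY : CMDiffAt ∞ (T% Y) x) :
    CMDiffAt ∞ (fun y ↦ ⟪X y, Y y⟫_ℝ) x :=
  ContMDiffAt.inner_bundle (E := fun x : M ↦ TangentSpace I x) (IB := I) (F := E) (b := id) hX hY

theorem contMDiffAt_koszul {X Y Z : Π x : M, TangentSpace I x} {x : M}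
    (hX : CMDiffAt ∞ (T% X) x) (hY : CMDiffAt ∞ (T% Y) x) (hZ : CMDiffAt ∞ (T% Z) x) :
    CMDiffAt ∞ (koszul I Y X Z) x := by
  unfold koszul
  exact (((((contMDiffAt_mvfderiv_apply (contMDiffAt_inner hY hZ) hX).add
    (contMDiffAt_mvfderiv_apply (contMDiffAt_inner hZ hX) hY)).sub
    (contMDiffAt_mvfderiv_apply (contMDiffAt_inner hX hY) hZ)).add
    (contMDiffAt_inner (contMDiffAt_mlieBracket hX hY) hZ)).sub
    (contMDiffAt_inner (contMDiffAt_mlieBracket hY hZ) hX)).add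
    (contMDiffAt_inner (contMDiffAt_mlieBracket hZ hX) hY)

/-- The metric is a smooth nondegenerate pairing: the coefficients of `Z` in a local frame are
obtained from its pairings with the frame by Cramer's rule for the Gram matrix. -/
theorem contMDiffAt_of_inner {Z : Π x : M, TangentSpace I x} {x : M}
    (h : ∀ s : Π x : M, TangentSpace I x, CMDiffAt ∞ (T% s) x →
      CMDiffAt ∞ (fun y ↦ ⟪s y, Z y⟫_ℝ) x) : CMDiffAt ∞ (T% Z) x := by
  classical
  let t := trivializationAt E (fun x : M ↦ TangentSpace I x) x
  have hx : x ∈ t.baseSet := FiberBundle.mem_baseSet_trivializationAt' x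
  let b := finBasis ℝ E
  let s := t.localFrame b
  have hs i : CMDiffAt ∞ (T% (s i)) x := contMDiffAt_localFrame_of_mem ∞ t b i hx
  let G (y : M) : Matrix (Fin (finrank ℝ E)) (Fin (finrank ℝ E)) ℝ := Matrix.gram ℝ (s · y)
  let w (y : M) (i : Fin (finrank ℝ E)) : ℝ := ⟪s i y, Z y⟫_ℝ
  have hG i j : CMDiffAt ∞ (fun y ↦ G y i j) x := contMDiffAt_inner (hs i) (hs j)
  have hw i : CMDiffAt ∞ (fun y ↦ w y i) x := h _ (hs i)
  have hdet y (hy : y ∈ t.baseSet) : (G y).det ≠ 0 := by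
    refine Matrix.det_gram_ne_zero_iff_linearIndependent.2 ?_
    convert! (t.basisAt b hy).linearIndependent using 1
    ext i
    simp [s, hy]
  have hc i : CMDiffAt ∞ (fun y ↦ (G y).det⁻¹ * (G y).cramer (w y) i) x := by
    refine ((contMDiffAt_det hG).inv₀ (hdet x hx)).mul ?_
    simp only [Matrix.cramer_apply]
    refine contMDiffAt_det fun k l ↦ ?_
    by_cases hl : l = i
    · subst hl; simpa using hw k
    · simpa [Matrix.updateCol_apply, hl] using hG k l
  refine (ContMDiffAt.sum_section (s := Finset.univ)
    fun i _ ↦ (hc i).smul_section (hs i)).congr_of_eventuallyEq ?_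
  filter_upwards [t.open_baseSet.mem_nhds hx] with y hy
  simp only [TotalSpace.mk_inj]
  -- two vectors with the same pairings with the frame at `y` agree
  refine InnerProductSpace.ext_inner_left_basis (𝕜 := ℝ) (t.basisAt b hy) fun k ↦ ?_
  have hk : t.basisAt b hy k = s k y := by simp [s, hy]
  rw [hk, inner_sum]
  have := congrFun ((G y).mulVec_cramer (w y)) k
  simp only [Matrix.mulVec, dotProduct, Pi.smul_apply, smul_eq_mul] at this
  simp only [Pi.smul_apply', inner_smul_right]
  calc w y k = (G y).det⁻¹ * ((G y).det * w y k) := by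
        rw [← mul_assoc, inv_mul_cancel₀ (hdet y hy), one_mul]
    _ = _ := by
      rw [← this, Finset.mul_sum]
      refine Finset.sum_congr rfl fun i _ ↦ ?_
      simp only [G, Matrix.gram_apply]; ring

end Smoothness

end Hypersurface

namespace Hypersurface

open Filter Topology

/-! ### Curvature of the Levi-Civita connection -/

section Curvature

variable {E : Type*} [NormedAddCommGroup E] [NormedSpace ℝ E] [FiniteDimensional ℝ E]
  {H : Type*} [TopologicalSpace H] {I : ModelWithCorners ℝ E H}
  {M : Type*} [TopologicalSpace M] [ChartedSpace H M] [IsManifold I ∞ M]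

theorem eventually_mdiffAt {X : Π x : M, TangentSpace I x} {x : M} (hX : CMDiffAt ∞ (T% X) x) :
    ∀ᶠ y in 𝓝 x, MDiffAt (T% X) y :=
  (contMDiffAt_iff_contMDiffAt_nhds (n := 1) (by simp)).1 (hX.of_le (by norm_num)) |>.mono
    fun _ h ↦ h.mdifferentiableAt one_ne_zero

theorem mdiffAt_of_contMDiffAt {X : Π x : M, TangentSpace I x} {x : M}
    (hX : CMDiffAt ∞ (T% X) x) : MDiffAt (T% X) x :=
  hX.mdifferentiableAt (by simp)

theorem eventually_mdiffAt_fun {f : M → ℝ} {x : M} (hf : CMDiffAt ∞ f x) :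
    ∀ᶠ y in 𝓝 x, MDiffAt f y :=
  (contMDiffAt_iff_contMDiffAt_nhds (n := 1) (by simp)).1 (hf.of_le (by norm_num)) |>.mono
    fun _ h ↦ h.mdifferentiableAt one_ne_zero

theorem mvfderiv_congr {f g : M → ℝ} {x : M} (h : f =ᶠ[𝓝 x] g) :
    mvfderiv I f x = mvfderiv I g x := by
  ext v
  simp only [mvfderiv, ContinuousLinearMap.comp_apply]
  rw [h.mfderiv_eq]
  rfl

theorem mvfderiv_subsingleton {f : M → ℝ} {x : M} (h : Subsingleton (TangentSpace I x))
    (v : TangentSpace I x) : mvfderiv I f x v = 0 := by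
  rw [Subsingleton.elim v 0, map_zero]

theorem mlieBracket_smul_right_eventuallyEq {f : M → ℝ} {X Z : Π x : M, TangentSpace I x} {x : M}
    (hf : CMDiffAt ∞ f x) (hZ : CMDiffAt ∞ (T% Z) x) :
    mlieBracket I X (f • Z) =ᶠ[𝓝 x]
      (fun y ↦ mvfderiv I f y (X y)) • Z + f • mlieBracket I X Z := by
  filter_upwards [eventually_mdiffAt_fun hf, eventually_mdiffAt hZ] with y hf hZ
  exact mlieBracket_smul_right hf hZ

/-- Jacobi's identity for `X`, `Y` and `f • Z` with `Z x ≠ 0`, expanded by the Leibniz rule, shows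
that the Lie bracket acts on functions as the commutator of derivations. -/
theorem mvfderiv_mlieBracket {f : M → ℝ} {X Y : Π x : M, TangentSpace I x} {x : M}
    (hf : CMDiffAt ∞ f x) (hX : CMDiffAt ∞ (T% X) x) (hY : CMDiffAt ∞ (T% Y) x) :
    mvfderiv I f x (mlieBracket I X Y x) =
      mvfderiv I (fun y ↦ mvfderiv I f y (Y y)) x (X x)
        - mvfderiv I (fun y ↦ mvfderiv I f y (X y)) x (Y x) := by
  rcases subsingleton_or_nontrivial (TangentSpace I x) with hs | hs
  · simp [mvfderiv_subsingleton hs]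
  obtain ⟨v, hv⟩ := exists_ne (0 : TangentSpace I x)
  let Z : Π x : M, TangentSpace I x := extend E v
  have hZx : Z x = v := extend_apply_self E v
  have hZ : CMDiffAt ∞ (T% Z) x := contMDiffAt_extend ..
  have : IsManifold I (minSmoothness ℝ 3) M :=
    .of_le (n := ∞) (by rw [minSmoothness_of_isRCLikeNormedField]; exact ENat.LEInfty.out)
  have : IsManifold I (minSmoothness ℝ 2) M :=
    .of_le (n := ∞) (by rw [minSmoothness_of_isRCLikeNormedField]; exact ENat.LEInfty.out)
  have h2 : minSmoothness ℝ 2 ≤ (∞ : WithTop ℕ∞) := by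
    rw [minSmoothness_of_isRCLikeNormedField]; exact ENat.LEInfty.out
  have hfZ : CMDiffAt ∞ (T% (f • Z)) x := hf.smul_section hZ
  have hXf := contMDiffAt_mvfderiv_apply hf hX
  have hYf := contMDiffAt_mvfderiv_apply hf hY
  have hXZ := contMDiffAt_mlieBracket hX hZ
  have hYZ := contMDiffAt_mlieBracket hY hZ
  have m {Z : Π x : M, TangentSpace I x} (h : CMDiffAt ∞ (T% Z) x) := mdiffAt_of_contMDiffAt h
  have mf {g : M → ℝ} (h : CMDiffAt ∞ g x) : MDiffAt g x := h.mdifferentiableAt (by simp)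
  have expand {U V : Π x : M, TangentSpace I x}
      (hV : CMDiffAt ∞ (T% V) x) :
      mlieBracket I U (mlieBracket I V (f • Z)) x =
        mvfderiv I (fun y ↦ mvfderiv I f y (V y)) x (U x) • Z x
          + mvfderiv I f x (V x) • mlieBracket I U Z x
          + (mvfderiv I f x (U x) • mlieBracket I V Z x
          + f x • mlieBracket I U (mlieBracket I V Z) x) := by
    have hVf := contMDiffAt_mvfderiv_apply hf hV
    have hVZ := contMDiffAt_mlieBracket hV hZ
    rw [EventuallyEq.rfl.mlieBracket_vectorField_eq (mlieBracket_smul_right_eventuallyEq hf hZ),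
      mlieBracket_add_right (m (hVf.smul_section hZ)) (m (hf.smul_section hVZ)),
      mlieBracket_smul_right (mf hVf) (m hZ), mlieBracket_smul_right (mf hf) (m hVZ)]
  have J := leibniz_identity_mlieBracket_apply (hX.of_le h2) (hY.of_le h2) (hfZ.of_le h2)
  have J' := leibniz_identity_mlieBracket_apply (hX.of_le h2) (hY.of_le h2) (hZ.of_le h2)
  rw [expand hY, expand hX, mlieBracket_smul_right (mf hf) (m hZ), J'] at J
  have key : (mvfderiv I f x (mlieBracket I X Y x) -
      (mvfderiv I (fun y ↦ mvfderiv I f y (Y y)) x (X x)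
        - mvfderiv I (fun y ↦ mvfderiv I f y (X y)) x (Y x))) • v = 0 := by
    rw [← hZx]
    linear_combination (norm := module) (-1 : ℝ) • J
  exact sub_eq_zero.1 ((smul_eq_zero.1 key).resolve_right hv)

end Curvature

end Hypersurface

namespace Hypersurface

open Filter Topology

section Connection

variable {E : Type*} [NormedAddCommGroup E] [NormedSpace ℝ E] [FiniteDimensional ℝ E]
  {H : Type*} [TopologicalSpace H] {I : ModelWithCorners ℝ E H}
  {M : Type*} [TopologicalSpace M] [ChartedSpace H M] [IsManifold I ∞ M]
  [RiemannianBundle (fun x : M ↦ TangentSpace I x)]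
  [IsContMDiffRiemannianBundle I ∞ E (fun x : M ↦ TangentSpace I x)]

variable (I) in
/-- The vector field `∇_X Y`. -/
noncomputable def cov (X Y : Π x : M, TangentSpace I x) (x : M) : TangentSpace I x :=
  leviCivita I Y x (X x)

theorem curvatureField_eq (X Y Z : Π x : M, TangentSpace I x) :
    curvatureField I X Y Z =
      cov I X (cov I Y Z) - cov I Y (cov I X Z) - cov I (mlieBracket I X Y) Z := rfl

theorem contMDiffAt_cov {X Y : Π x : M, TangentSpace I x} {x : M}
    (hX : CMDiffAt ∞ (T% X) x) (hY : CMDiffAt ∞ (T% Y) x) : CMDiffAt ∞ (T% (cov I X Y)) x := by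
  refine contMDiffAt_of_inner fun s hs ↦ ?_
  refine (contMDiffAt_const (c := (2⁻¹ : ℝ)).mul
    (contMDiffAt_koszul hX hY hs)).congr_of_eventuallyEq ?_
  filter_upwards [eventually_mdiffAt hX, eventually_mdiffAt hY, eventually_mdiffAt hs]
    with y hX hY hs
  rw [real_inner_comm]
  exact inner_nabla I hX hY hs

theorem cov_add_right {X Y Y' : Π x : M, TangentSpace I x} {x : M}
    (hY : MDiffAt (T% Y) x) (hY' : MDiffAt (T% Y') x) :
    cov I X (Y + Y') x = cov I X Y x + cov I X Y' x := by
  simp [cov, (leviCivita I).isCovariantDerivativeOnUniv.add hY hY']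

theorem cov_smul_right {f : M → ℝ} {X Y : Π x : M, TangentSpace I x} {x : M}
    (hf : MDiffAt f x) (hY : MDiffAt (T% Y) x) :
    cov I X (f • Y) x = f x • cov I X Y x + mvfderiv I f x (X x) • Y x := by
  simp [cov, (leviCivita I).isCovariantDerivativeOnUniv.leibniz hY hf]

theorem cov_neg_right {X Y : Π x : M, TangentSpace I x} {x : M} (hY : MDiffAt (T% Y) x) :
    cov I X (-Y) x = -cov I X Y x := by
  have := (leviCivita I).isCovariantDerivativeOnUniv.smul_const (-1 : ℝ) hY
  simp only [neg_smul, one_smul] at this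
  simp [cov, this]

theorem cov_sub_right {X Y Y' : Π x : M, TangentSpace I x} {x : M}
    (hY : MDiffAt (T% Y) x) (hY' : MDiffAt (T% Y') x) :
    cov I X (Y - Y') x = cov I X Y x - cov I X Y' x := by
  rw [sub_eq_add_neg, cov_add_right hY (mdifferentiableAt_neg_section hY'), cov_neg_right hY',
    ← sub_eq_add_neg]

theorem cov_congr_right {X Y Y' : Π x : M, TangentSpace I x} {x : M}
    (hY : MDiffAt (T% Y) x) (h : Y =ᶠ[𝓝 x] Y') :
    cov I X Y x = cov I X Y' x := by
  have hY' : MDiffAt (T% Y') x :=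
    hY.congr_of_eventuallyEq (h.mono fun y hy ↦ by simp [hy])
  simp [cov, (leviCivita I).isCovariantDerivativeOnUniv.congr_of_eventuallyEq hY hY' univ_mem h]

theorem cov_sub_cov {X Y : Π x : M, TangentSpace I x} {x : M}
    (hX : MDiffAt (T% X) x) (hY : MDiffAt (T% Y) x) :
    cov I X Y x - cov I Y X x = mlieBracket I X Y x :=
  (CovariantDerivative.torsion_eq_zero_iff _).1 (leviCivita_torsion I) hX hY

theorem mvfderiv_inner {X Y Z : Π x : M, TangentSpace I x} {x : M}
    (hY : MDiffAt (T% Y) x) (hZ : MDiffAt (T% Z) x) :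
    mvfderiv I (fun y ↦ ⟪Y y, Z y⟫_ℝ) x (X x) = ⟪cov I X Y x, Z x⟫_ℝ + ⟪Y x, cov I X Z x⟫_ℝ :=
  (leviCivita_metric I).mvfderiv_inner_eq X hY hZ

theorem contMDiffAt_sub {X Y : Π x : M, TangentSpace I x} {x : M}
    (hX : CMDiffAt ∞ (T% X) x) (hY : CMDiffAt ∞ (T% Y) x) : CMDiffAt ∞ (T% (X - Y)) x :=
  hX.sub_section hY

theorem contMDiffAt_curvatureField {X Y Z : Π x : M, TangentSpace I x} {x : M}
    (hX : CMDiffAt ∞ (T% X) x) (hY : CMDiffAt ∞ (T% Y) x) (hZ : CMDiffAt ∞ (T% Z) x) :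
    CMDiffAt ∞ (T% (curvatureField I X Y Z)) x :=
  contMDiffAt_sub (contMDiffAt_sub (contMDiffAt_cov hX (contMDiffAt_cov hY hZ))
    (contMDiffAt_cov hY (contMDiffAt_cov hX hZ)))
    (contMDiffAt_cov (contMDiffAt_mlieBracket hX hY) hZ)

theorem curvatureField_swap (X Y Z : Π x : M, TangentSpace I x) (x : M) :
    curvatureField I Y X Z x = -curvatureField I X Y Z x := by
  simp only [curvatureField]
  rw [mlieBracket_swap_apply (V := Y) (W := X), map_neg]
  abel

theorem curvatureField_add_left {X X' Y Z : Π x : M, TangentSpace I x} {x : M}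
    (hX : CMDiffAt ∞ (T% X) x) (hX' : CMDiffAt ∞ (T% X') x)
    (hZ : CMDiffAt ∞ (T% Z) x) :
    curvatureField I (X + X') Y Z x = curvatureField I X Y Z x + curvatureField I X' Y Z x := by
  have m {Z : Π x : M, TangentSpace I x} (h : CMDiffAt ∞ (T% Z) x) := mdiffAt_of_contMDiffAt h
  have h : cov I (X + X') Z = cov I X Z + cov I X' Z := by ext y; simp [cov]
  simp only [curvatureField_eq, Pi.sub_apply, h,
    cov_add_right (m (contMDiffAt_cov hX hZ)) (m (contMDiffAt_cov hX' hZ))]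
  simp only [cov, Pi.add_apply, map_add, mlieBracket_add_left (m hX) (m hX')]
  abel

theorem curvatureField_smul_left {f : M → ℝ} {X Y Z : Π x : M, TangentSpace I x} {x : M}
    (hf : CMDiffAt ∞ f x) (hX : CMDiffAt ∞ (T% X) x) (hZ : CMDiffAt ∞ (T% Z) x) :
    curvatureField I (f • X) Y Z x = f x • curvatureField I X Y Z x := by
  have m {Z : Π x : M, TangentSpace I x} (h : CMDiffAt ∞ (T% Z) x) := mdiffAt_of_contMDiffAt h
  have mf : MDiffAt f x := hf.mdifferentiableAt (by simp)
  have h : cov I (f • X) Z = f • cov I X Z := by ext y; simp [cov]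
  simp only [curvatureField_eq, Pi.sub_apply, h,
    cov_smul_right mf (m (contMDiffAt_cov hX hZ))]
  simp only [cov, Pi.smul_apply', map_add, map_smul, mlieBracket_smul_left mf (m hX)]
  simp only [neg_smul]
  module

theorem curvatureField_add_right {X Y Z Z' : Π x : M, TangentSpace I x} {x : M}
    (hX : CMDiffAt ∞ (T% X) x) (hY : CMDiffAt ∞ (T% Y) x) (hZ : CMDiffAt ∞ (T% Z) x)
    (hZ' : CMDiffAt ∞ (T% Z') x) :
    curvatureField I X Y (Z + Z') x = curvatureField I X Y Z x + curvatureField I X Y Z' x := by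
  have m {Z : Π x : M, TangentSpace I x} (h : CMDiffAt ∞ (T% Z) x) := mdiffAt_of_contMDiffAt h
  have h (U V : Π x : M, TangentSpace I x) (hV : CMDiffAt ∞ (T% V) x) :
      cov I U (cov I V (Z + Z')) x = cov I U (cov I V Z) x + cov I U (cov I V Z') x := by
    rw [← cov_add_right (m (contMDiffAt_cov hV hZ)) (m (contMDiffAt_cov hV hZ'))]
    refine cov_congr_right (m (contMDiffAt_cov hV (hZ.add_section hZ'))) ?_
    filter_upwards [eventually_mdiffAt hZ, eventually_mdiffAt hZ'] with y h1 h2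
      using cov_add_right h1 h2
  simp only [curvatureField_eq, Pi.sub_apply, h _ _ hX, h _ _ hY, cov_add_right (m hZ) (m hZ')]
  abel

theorem curvatureField_smul_right {f : M → ℝ} {X Y Z : Π x : M, TangentSpace I x} {x : M}
    (hf : CMDiffAt ∞ f x) (hX : CMDiffAt ∞ (T% X) x) (hY : CMDiffAt ∞ (T% Y) x)
    (hZ : CMDiffAt ∞ (T% Z) x) :
    curvatureField I X Y (f • Z) x = f x • curvatureField I X Y Z x := by
  have m {Z : Π x : M, TangentSpace I x} (h : CMDiffAt ∞ (T% Z) x) := mdiffAt_of_contMDiffAt h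
  have mf {g : M → ℝ} (h : CMDiffAt ∞ g x) : MDiffAt g x := h.mdifferentiableAt (by simp)
  have h (U V : Π x : M, TangentSpace I x) (hV : CMDiffAt ∞ (T% V) x) :
      cov I U (cov I V (f • Z)) x = f x • cov I U (cov I V Z) x
        + mvfderiv I f x (U x) • cov I V Z x + mvfderiv I f x (V x) • cov I U Z x
        + mvfderiv I (fun y ↦ mvfderiv I f y (V y)) x (U x) • Z x := by
    have hVf := contMDiffAt_mvfderiv_apply hf hV
    have hVZ := contMDiffAt_cov hV hZ
    have e : cov I V (f • Z) =ᶠ[𝓝 x] f • cov I V Z + (fun y ↦ mvfderiv I f y (V y)) • Z := by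
      filter_upwards [eventually_mdiffAt hZ, eventually_mdiffAt_fun hf] with y h1 h2
        using cov_smul_right h2 h1
    rw [cov_congr_right (m (contMDiffAt_cov hV (hf.smul_section hZ))) e,
      cov_add_right (m (hf.smul_section hVZ)) (m (hVf.smul_section hZ)),
      cov_smul_right (mf hf) (m hVZ), cov_smul_right (mf hVf) (m hZ)]
    abel
  simp only [curvatureField_eq, Pi.sub_apply, h _ _ hX, h _ _ hY, cov_smul_right (mf hf) (m hZ),
    mvfderiv_mlieBracket hf hX hY]
  module

/-- The commutator of the derivatives along `X` and `Y` of the function `⟪Z, W⟫` is its derivative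
along `[X, Y]`; expanding both sides by metric compatibility, the mixed terms cancel. -/
theorem inner_curvatureField_swap {X Y Z W : Π x : M, TangentSpace I x} {x : M}
    (hX : CMDiffAt ∞ (T% X) x) (hY : CMDiffAt ∞ (T% Y) x) (hZ : CMDiffAt ∞ (T% Z) x)
    (hW : CMDiffAt ∞ (T% W) x) :
    ⟪curvatureField I X Y Z x, W x⟫_ℝ = -⟪curvatureField I X Y W x, Z x⟫_ℝ := by
  have m {Z : Π x : M, TangentSpace I x} (h : CMDiffAt ∞ (T% Z) x) := mdiffAt_of_contMDiffAt h
  have mf {g : M → ℝ} (h : CMDiffAt ∞ g x) : MDiffAt g x := h.mdifferentiableAt (by simp)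
  have h (U V : Π x : M, TangentSpace I x) (hV : CMDiffAt ∞ (T% V) x) :
      mvfderiv I (fun y ↦ mvfderiv I (fun y ↦ ⟪Z y, W y⟫_ℝ) y (V y)) x (U x) =
        ⟪cov I U (cov I V Z) x, W x⟫_ℝ + ⟪cov I V Z x, cov I U W x⟫_ℝ
          + (⟪cov I U Z x, cov I V W x⟫_ℝ + ⟪Z x, cov I U (cov I V W) x⟫_ℝ) := by
    have e : (fun y ↦ mvfderiv I (fun y ↦ ⟪Z y, W y⟫_ℝ) y (V y)) =ᶠ[𝓝 x]
        (fun y ↦ ⟪cov I V Z y, W y⟫_ℝ) + fun y ↦ ⟪Z y, cov I V W y⟫_ℝ := by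
      filter_upwards [eventually_mdiffAt hZ, eventually_mdiffAt hW] with y h1 h2
        using mvfderiv_inner h1 h2
    rw [mvfderiv_congr e, mvfderiv_add (mf (contMDiffAt_inner (contMDiffAt_cov hV hZ) hW))
      (mf (contMDiffAt_inner hZ (contMDiffAt_cov hV hW))), add_apply,
      mvfderiv_inner (m (contMDiffAt_cov hV hZ)) (m hW),
      mvfderiv_inner (m hZ) (m (contMDiffAt_cov hV hW))]
  have key := mvfderiv_mlieBracket (contMDiffAt_inner hZ hW) hX hY
  rw [h _ _ hX, h _ _ hY, mvfderiv_inner (m hZ) (m hW)] at key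
  simp only [curvatureField_eq, Pi.sub_apply, inner_sub_left]
  rw [real_inner_comm (Z x) (cov I X _ x), real_inner_comm (Z x) (cov I Y _ x),
    real_inner_comm (Z x) (cov I (mlieBracket I X Y) W x)]
  linarith

end Connection

end Hypersurface

namespace Hypersurface

open Filter Topology

/-! ### Tensoriality of the curvature and the second Bianchi identity -/

section Tensoriality

variable {E : Type*} [NormedAddCommGroup E] [NormedSpace ℝ E] [FiniteDimensional ℝ E]
  {H : Type*} [TopologicalSpace H] {I : ModelWithCorners ℝ E H}
  {M : Type*} [TopologicalSpace M] [ChartedSpace H M] [IsManifold I ∞ M]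
  {A : Type*} [AddCommGroup A] [Module ℝ A]

variable (I) in
/-- An operation on vector fields is *smoothly tensorial* at `x` if it is linear over germs at `x`
of smooth functions, on vector fields that are smooth at `x`. The curvature differentiates twice,
so that `TensorialAt`, which quantifies over differentiable fields, does not apply to it. -/
structure SmoothTensorialAt (Φ : (Π x : M, TangentSpace I x) → A) (x : M) : Prop where
  smul : ∀ {f : M → ℝ} {X : Π x : M, TangentSpace I x}, CMDiffAt ∞ f x → CMDiffAt ∞ (T% X) x →
    Φ (f • X) = f x • Φ X
  add : ∀ {X Y : Π x : M, TangentSpace I x}, CMDiffAt ∞ (T% X) x → CMDiffAt ∞ (T% Y) x →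
    Φ (X + Y) = Φ X + Φ Y

namespace SmoothTensorialAt

variable {Φ : (Π x : M, TangentSpace I x) → A} {x : M}

theorem congr_germ (hΦ : SmoothTensorialAt I Φ x) {X Y : Π x : M, TangentSpace I x}
    (hX : CMDiffAt ∞ (T% X) x) (hY : CMDiffAt ∞ (T% Y) x) (h : X =ᶠ[𝓝 x] Y) : Φ X = Φ Y := by
  classical
  -- both fields have the same product with the indicator function of the set where they agree
  let ψ (y : M) : ℝ := if X y = Y y then 1 else 0
  have hψx : ψ x = 1 := by simp [ψ, h.self_of_nhds]
  have e : ψ • X = ψ • Y := by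
    ext y
    by_cases hy : X y = Y y <;> simp [ψ, hy]
  have hψ : CMDiffAt ∞ ψ x :=
    (contMDiffAt_const (c := (1 : ℝ))).congr_of_eventuallyEq (h.mono fun y hy ↦ by simp [ψ, hy])
  simpa [hΦ.smul hψ hX, hΦ.smul hψ hY, hψx] using congrArg Φ e

theorem zero (hΦ : SmoothTensorialAt I Φ x) : Φ 0 = 0 := by
  have h0 : CMDiffAt ∞ (T% (0 : Π x : M, TangentSpace I x)) x := contMDiffAt_zeroSection ..
  simpa using hΦ.add h0 h0

theorem sum (hΦ : SmoothTensorialAt I Φ x) {ι : Type*} (s : Finset ι)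
    {X : ι → Π x : M, TangentSpace I x} (hX : ∀ i, CMDiffAt ∞ (T% (X i)) x) :
    Φ (∑ i ∈ s, X i) = ∑ i ∈ s, Φ (X i) := by
  classical
  induction s using Finset.induction_on with
  | empty => simpa using hΦ.zero
  | insert a s ha ih =>
    rw [Finset.sum_insert ha, Finset.sum_insert ha, ← ih]
    refine hΦ.add (hX a) ?_
    simpa only [Finset.sum_apply] using ContMDiffAt.sum_section (s := s) fun i _ ↦ hX i

/-- Expand in a local frame, with coefficients that are smooth at `x`. -/
theorem pointwise (hΦ : SmoothTensorialAt I Φ x) {X Y : Π x : M, TangentSpace I x}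
    (hX : CMDiffAt ∞ (T% X) x) (hY : CMDiffAt ∞ (T% Y) x) (h : X x = Y x) : Φ X = Φ Y := by
  let t := trivializationAt E (fun x : M ↦ TangentSpace I x) x
  have hx : x ∈ t.baseSet := FiberBundle.mem_baseSet_trivializationAt' x
  let b := finBasis ℝ E
  let s := t.localFrame b
  let c := t.localFrameCoeff I b
  have hs i : CMDiffAt ∞ (T% (s i)) x := contMDiffAt_localFrame_of_mem ∞ t b i hx
  have hc {X : Π x : M, TangentSpace I x} (hX : CMDiffAt ∞ (T% X) x) i :
      CMDiffAt ∞ (LinearMap.piApply (c i) X) x := contMDiffAt_localFrameCoeff b hx hX i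
  have key {X : Π x : M, TangentSpace I x} (hX : CMDiffAt ∞ (T% X) x) :
      Φ X = ∑ i, c i x (X x) • Φ (s i) := by
    have hsum : CMDiffAt ∞ (T% (∑ i, LinearMap.piApply (c i) X • s i)) x := by
      simpa only [Finset.sum_apply] using
        ContMDiffAt.sum_section (s := Finset.univ) fun i _ ↦ (hc hX i).smul_section (hs i)
    rw [hΦ.congr_germ hX hsum, hΦ.sum _ fun i ↦ (hc hX i).smul_section (hs i)]
    · exact Finset.sum_congr rfl fun i _ ↦ hΦ.smul (hc hX i) (hs i)
    · filter_upwards [t.eventually_eq_localFrame_sum_coeff_smul (I := I) b hx (s := X)] with y hy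
      rw [Finset.sum_apply]
      exact hy
  rw [key hX, key hY, h]

end SmoothTensorialAt

end Tensoriality

section Riemann

variable {E : Type*} [NormedAddCommGroup E] [NormedSpace ℝ E] [FiniteDimensional ℝ E]
  {H : Type*} [TopologicalSpace H] {I : ModelWithCorners ℝ E H}
  {M : Type*} [TopologicalSpace M] [ChartedSpace H M] [IsManifold I ∞ M]
  [RiemannianBundle (fun x : M ↦ TangentSpace I x)]
  [IsContMDiffRiemannianBundle I ∞ E (fun x : M ↦ TangentSpace I x)]

theorem curvatureField_congr {X X' Y Y' Z Z' : Π x : M, TangentSpace I x} {x : M}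
    (hX : CMDiffAt ∞ (T% X) x) (hX' : CMDiffAt ∞ (T% X') x) (hXX : X x = X' x)
    (hY : CMDiffAt ∞ (T% Y) x) (hY' : CMDiffAt ∞ (T% Y') x) (hYY : Y x = Y' x)
    (hZ : CMDiffAt ∞ (T% Z) x) (hZ' : CMDiffAt ∞ (T% Z') x) (hZZ : Z x = Z' x) :
    curvatureField I X Y Z x = curvatureField I X' Y' Z' x := by
  have left {Y Z : Π x : M, TangentSpace I x} (hZ : CMDiffAt ∞ (T% Z) x) :
      SmoothTensorialAt I (fun X ↦ curvatureField I X Y Z x) x :=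
    ⟨fun hf hX ↦ curvatureField_smul_left hf hX hZ,
      fun hX hX' ↦ curvatureField_add_left hX hX' hZ⟩
  have right : SmoothTensorialAt I (fun Z ↦ curvatureField I X' Y' Z x) x :=
    ⟨fun hf hZ ↦ curvatureField_smul_right hf hX' hY' hZ,
      fun hZ hZ' ↦ curvatureField_add_right hX' hY' hZ hZ'⟩
  calc curvatureField I X Y Z x
    _ = curvatureField I X' Y Z x := (left hZ).pointwise hX hX' hXX
    _ = -curvatureField I Y X' Z x := curvatureField_swap ..
    _ = -curvatureField I Y' X' Z x := congrArg _ ((left hZ).pointwise hY hY' hYY)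
    _ = curvatureField I X' Y' Z x := (curvatureField_swap ..).symm
    _ = curvatureField I X' Y' Z' x := right.pointwise hZ hZ' hZZ

theorem riemann_apply {A B X Y : Π x : M, TangentSpace I x} {x : M}
    (hB : CMDiffAt ∞ (T% B) x)
    (hX : CMDiffAt ∞ (T% X) x) (hY : CMDiffAt ∞ (T% Y) x) :
    riemann I x (A x) (B x) (X x) (Y x) = ⟪curvatureField I X Y B x, A x⟫_ℝ := by
  rw [riemann, curvatureField_congr (contMDiffAt_extend ..) hX (extend_apply_self ..)
    (contMDiffAt_extend ..) hY (extend_apply_self ..) (contMDiffAt_extend ..) hB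
    (extend_apply_self ..)]

theorem riemann_swap_right (x : M) (a b c d : TangentSpace I x) :
    riemann I x a b d c = -riemann I x a b c d := by
  simp only [riemann]
  rw [curvatureField_swap, inner_neg_left]

theorem riemann_swap_left (x : M) (a b c d : TangentSpace I x) :
    riemann I x b a c d = -riemann I x a b c d := by
  have := inner_curvatureField_swap (I := I) (X := extend E c) (Y := extend E d) (Z := extend E b)
    (W := extend E a) (x := x) (contMDiffAt_extend ..) (contMDiffAt_extend ..)
    (contMDiffAt_extend ..) (contMDiffAt_extend ..)
  simp only [extend_apply_self] at this
  simp only [riemann, this, neg_neg]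

theorem riemann_add_fst (x : M) (a a' b c d : TangentSpace I x) :
    riemann I x (a + a') b c d = riemann I x a b c d + riemann I x a' b c d :=
  inner_add_right ..

theorem riemann_smul_fst (x : M) (r : ℝ) (a b c d : TangentSpace I x) :
    riemann I x (r • a) b c d = r * riemann I x a b c d :=
  inner_smul_right ..

theorem riemann_add_trd (x : M) (a b c c' d : TangentSpace I x) :
    riemann I x a b (c + c') d = riemann I x a b c d + riemann I x a b c' d := by
  have h (v : TangentSpace I x) : CMDiffAt ∞ (T% (extend E v)) x := contMDiffAt_extend ..
  have := riemann_apply (A := extend E a) (h b) ((h c).add_section (h c')) (h d)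
  simp only [Pi.add_apply, extend_apply_self] at this
  rw [this]
  simp only [riemann]
  rw [← inner_add_left, ← curvatureField_add_left (h c) (h c') (h b)]

theorem riemann_smul_trd (x : M) (r : ℝ) (a b c d : TangentSpace I x) :
    riemann I x a b (r • c) d = r * riemann I x a b c d := by
  have h (v : TangentSpace I x) : CMDiffAt ∞ (T% (extend E v)) x := contMDiffAt_extend ..
  have hr : CMDiffAt ∞ (fun _ : M ↦ r) x := contMDiffAt_const
  have := riemann_apply (A := extend E a) (h b) (hr.smul_section (h c)) (h d)
  simp only [Pi.smul_apply', extend_apply_self] at this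
  rw [this, curvatureField_smul_left hr (h c) (h b), inner_smul_left]
  simp [riemann]

theorem contMDiffAt_riemann {A B X Y : Π x : M, TangentSpace I x} {x : M}
    (hA : CMDiffAt ∞ (T% A) x) (hB : ∀ᶠ y in 𝓝 x, CMDiffAt ∞ (T% B) y)
    (hX : ∀ᶠ y in 𝓝 x, CMDiffAt ∞ (T% X) y) (hY : ∀ᶠ y in 𝓝 x, CMDiffAt ∞ (T% Y) y) :
    CMDiffAt ∞ (fun y ↦ riemann I y (A y) (B y) (X y) (Y y)) x := by
  refine (contMDiffAt_inner (contMDiffAt_curvatureField hX.self_of_nhds hY.self_of_nhds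
    hB.self_of_nhds) hA).congr_of_eventuallyEq ?_
  filter_upwards [hB, hX, hY] with y hB hX hY using riemann_apply hB hX hY

/-- The sum of `(∇_X R)(Y, Z) W` over the cyclic permutations of `X, Y, Z` is zero: the third
covariant derivatives of `W` cancel, the torsion vanishes, and the nested brackets satisfy Jacobi's
identity. -/
theorem second_bianchi {X Y Z W : Π x : M, TangentSpace I x} {x : M}
    (hX : CMDiffAt ∞ (T% X) x) (hY : CMDiffAt ∞ (T% Y) x) (hZ : CMDiffAt ∞ (T% Z) x)
    (hW : CMDiffAt ∞ (T% W) x) :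
    (cov I X (curvatureField I Y Z W) - curvatureField I Y Z (cov I X W)
        - curvatureField I (cov I X Y) Z W - curvatureField I Y (cov I X Z) W
      + (cov I Y (curvatureField I Z X W) - curvatureField I Z X (cov I Y W)
        - curvatureField I (cov I Y Z) X W - curvatureField I Z (cov I Y X) W)
      + (cov I Z (curvatureField I X Y W) - curvatureField I X Y (cov I Z W)
        - curvatureField I (cov I Z X) Y W - curvatureField I X (cov I Z Y) W)) x = 0 := by
  have m {Z : Π x : M, TangentSpace I x} (h : CMDiffAt ∞ (T% Z) x) := mdiffAt_of_contMDiffAt h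
  have h2 : minSmoothness ℝ 2 ≤ (∞ : WithTop ℕ∞) := by
    rw [minSmoothness_of_isRCLikeNormedField]; exact ENat.LEInfty.out
  have : IsManifold I (minSmoothness ℝ 3) M :=
    .of_le (n := ∞) (by rw [minSmoothness_of_isRCLikeNormedField]; exact ENat.LEInfty.out)
  -- the terms with `∇_U V` in a slot of the curvature combine, as the torsion vanishes
  have tor {U V T : Π x : M, TangentSpace I x} (hU : CMDiffAt ∞ (T% U) x)
      (hV : CMDiffAt ∞ (T% V) x) (hT : CMDiffAt ∞ (T% T) x) :
      curvatureField I (cov I U V) T W x + curvatureField I T (cov I V U) W x =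
        -(cov I T (cov I (mlieBracket I U V) W) x - cov I (mlieBracket I U V) (cov I T W) x
          - cov I (mlieBracket I T (mlieBracket I U V)) W x) := by
    have hUV := contMDiffAt_mlieBracket hU hV
    have e : curvatureField I (cov I U V) T W x = curvatureField I (mlieBracket I U V) T W x
        + curvatureField I (cov I V U) T W x := by
      rw [← curvatureField_add_left hUV (contMDiffAt_cov hV hU) hW]
      refine curvatureField_congr (contMDiffAt_cov hU hV)
        (hUV.add_section (contMDiffAt_cov hV hU)) ?_ hT hT rfl hW hW rfl
      rw [Pi.add_apply, ← cov_sub_cov (m hU) (m hV)]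
      abel
    rw [e, curvatureField_swap T (mlieBracket I U V), curvatureField_swap (cov I V U) T,
      curvatureField_eq]
    simp only [Pi.sub_apply]
    abel
  have exp {U V T : Π x : M, TangentSpace I x} (hU : CMDiffAt ∞ (T% U) x)
      (hV : CMDiffAt ∞ (T% V) x) :
      cov I T (curvatureField I U V W) x = cov I T (cov I U (cov I V W)) x
        - cov I T (cov I V (cov I U W)) x - cov I T (cov I (mlieBracket I U V) W) x := by
    have h1 := contMDiffAt_cov hU (contMDiffAt_cov hV hW)
    have h2 := contMDiffAt_cov hV (contMDiffAt_cov hU hW)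
    rw [curvatureField_eq, cov_sub_right (m (contMDiffAt_sub h1 h2))
      (m (contMDiffAt_cov (contMDiffAt_mlieBracket hU hV) hW)), cov_sub_right (m h1) (m h2)]
  have jac : cov I (mlieBracket I X (mlieBracket I Y Z)) W x
      + cov I (mlieBracket I Y (mlieBracket I Z X)) W x
      + cov I (mlieBracket I Z (mlieBracket I X Y)) W x = 0 := by
    have J := leibniz_identity_mlieBracket_apply (hX.of_le h2) (hY.of_le h2) (hZ.of_le h2)
    have n : mlieBracket I Y (mlieBracket I X Z) x = -mlieBracket I Y (mlieBracket I Z X) x := by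
      have := mlieBracket_const_smul_right (c := (-1 : ℝ)) (V := Y)
        (m (contMDiffAt_mlieBracket hZ hX))
      rw [mlieBracket_swap (V := X) (W := Z)]
      simpa using this
    rw [n, mlieBracket_swap_apply (V := mlieBracket I X Y)] at J
    simp only [cov, J, map_add, map_neg]
    abel
  have t1 := tor hX hY hZ
  have t2 := tor hY hZ hX
  have t3 := tor hZ hX hY
  simp only [Pi.add_apply, Pi.sub_apply, exp hX hY, exp hY hZ, exp hZ hX]
  simp only [curvatureField_eq _ _ (cov I _ _), Pi.sub_apply]
  linear_combination (norm := module) (-1 : ℝ) • t1 - t2 - t3 - jac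

end Riemann

end Hypersurface

namespace Hypersurface

open Filter Topology

/-! ### The Gauss equation implies the Codazzi equation -/

/-- The algebra behind "Gauss implies Codazzi". In a basis `v` that is orthogonal for `h`, write
`T i j k = F (v k) (v i) (v j) - F (v j) (v i) (v k)`. The identity `hF` at
`v a, v b, v j, v b, v k` gives `T a j k = 0` when `a, b, j, k` are distinct. With `j = a` it gives
`T a a k / h (v a) (v a) = - T b b k / h (v b) (v b)` when `a, b, k` are distinct; three indices
different from `k` make both sides vanish. -/
theorem codazzi_of_differentiated_gauss {V : Type*} [AddCommGroup V] [Module ℝ V]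
    [FiniteDimensional ℝ V]
    (hn : 3 < finrank ℝ V) {h : LinearMap.BilinForm ℝ V} (hs : ∀ u v, h u v = h v u)
    (hpos : ∀ u v, LinearIndependent ℝ ![u, v] → 0 < h u u * h v v - h u v * h v u)
    (F : V →ₗ[ℝ] V →ₗ[ℝ] V →ₗ[ℝ] ℝ)
    (hF : ∀ a b c d e,
      (F e a c * h b d + h a c * F e b d - F e a d * h b c - h a d * F e b c)
      + (F c a d * h b e + h a d * F c b e - F c a e * h b d - h a e * F c b d)
      + (F d a e * h b c + h a e * F d b c - F d a c * h b e - h a c * F d b e) = 0)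
    (a b c : V) : F c a b = F b a c := by
  obtain ⟨v, hv⟩ := LinearMap.BilinForm.exists_orthogonal_basis (B := h) ⟨fun x y ↦ hs x y⟩
  have ho {i j} (hij : i ≠ j) : h (v i) (v j) = 0 := hv hij
  have pos {i j} (hij : i ≠ j) : 0 < h (v i) (v i) * h (v j) (v j) := by
    have hli : LinearIndependent ℝ ![v i, v j] := by
      have := v.linearIndependent.comp ![i, j] (by
        intro p q hpq
        fin_cases p <;> fin_cases q <;> simp_all [eq_comm])
      convert! this using 1
      ext p; fin_cases p <;> rfl
    simpa [ho hij] using hpos _ _ hli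
  have card : 3 < Fintype.card (Fin (finrank ℝ V)) := by simpa using hn
  have fresh (s : Finset (Fin (finrank ℝ V))) (hc : s.card ≤ 3) : ∃ l, l ∉ s := by
    by_contra! hall
    have : s = Finset.univ := Finset.eq_univ_iff_forall.2 hall
    rw [this, Finset.card_univ] at hc
    omega
  have ne i : h (v i) (v i) ≠ 0 := by
    obtain ⟨l, hl⟩ := fresh {i} (by simp)
    have := pos (i := i) (j := l) (by rintro rfl; simp at hl)
    exact left_ne_zero_of_mul this.ne'
  have main (i j k) : F (v k) (v i) (v j) = F (v j) (v i) (v k) := by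
    have distinct {i j k} (hij : i ≠ j) (hik : i ≠ k) (hjk : j ≠ k) :
        F (v k) (v i) (v j) = F (v j) (v i) (v k) := by
      obtain ⟨l, hl⟩ := fresh {i, j, k} Finset.card_le_three
      simp only [Finset.mem_insert, Finset.mem_singleton, not_or] at hl
      have := hF (v i) (v l) (v j) (v l) (v k)
      simp only [ho hij, ho hik, ho hl.2.1, ho hl.2.2, ho (Ne.symm hl.1)] at this
      have key : h (v l) (v l) * (F (v k) (v i) (v j) - F (v j) (v i) (v k)) = 0 := by linarith
      exact sub_eq_zero.1 ((mul_eq_zero.1 key).resolve_left (ne l))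
    have rel {i l k} (hil : i ≠ l) (hik : i ≠ k) (hlk : l ≠ k) :
        h (v l) (v l) * (F (v k) (v i) (v i) - F (v i) (v i) (v k)) +
          h (v i) (v i) * (F (v k) (v l) (v l) - F (v l) (v l) (v k)) = 0 := by
      have := hF (v i) (v l) (v i) (v l) (v k)
      simp only [ho hil, ho hik, ho hlk, ho hil.symm] at this
      linarith
    have diag {i k} (hik : i ≠ k) : F (v k) (v i) (v i) = F (v i) (v i) (v k) := by
      obtain ⟨l, hl⟩ := fresh {i, k} (Finset.card_le_two.trans (by norm_num))
      obtain ⟨m, hm⟩ := fresh {i, k, l} Finset.card_le_three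
      simp only [Finset.mem_insert, Finset.mem_singleton, not_or] at hl hm
      have e1 := rel (Ne.symm hl.1) hik hl.2
      have e2 := rel (Ne.symm hm.1) hik hm.2.1
      have e3 := rel (Ne.symm hm.2.2) hl.2 hm.2.1
      have key : 2 * h (v l) (v l) * h (v m) (v m) *
          (F (v k) (v i) (v i) - F (v i) (v i) (v k)) = 0 := by
        linear_combination h (v m) (v m) * e1 + h (v l) (v l) * e2 - h (v i) (v i) * e3
      simpa [ne l, ne m, sub_eq_zero] using key
    by_cases hjk : j = k
    · rw [hjk]
    by_cases hij : i = j
    · subst hij; exact diag hjk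
    by_cases hik : i = k
    · subst hik; exact (diag hij).symm
    exact distinct hij hik hjk
  have e : F.flip = LinearMap.lflip.comp F.flip := by
    refine v.ext fun i ↦ v.ext fun k ↦ v.ext fun j ↦ ?_
    simpa using main i j k
  simpa using congrArg (fun G ↦ G a c b) e

section Geometric

variable {E : Type*} [NormedAddCommGroup E] [NormedSpace ℝ E] [FiniteDimensional ℝ E]
  {H : Type*} [TopologicalSpace H] {I : ModelWithCorners ℝ E H}
  {M : Type*} [TopologicalSpace M] [ChartedSpace H M] [IsManifold I ∞ M]
  [RiemannianBundle (fun x : M ↦ TangentSpace I x)]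
  [IsContMDiffRiemannianBundle I ∞ E (fun x : M ↦ TangentSpace I x)]
  {h : Π x : M, TangentSpace I x →L[ℝ] TangentSpace I x →L[ℝ] ℝ}

theorem IsSmoothSymmetric.mdiffAt_apply (hh : IsSmoothSymmetric I h)
    {X Y : Π x : M, TangentSpace I x} {x : M} (hX : MDiffAt (T% X) x) (hY : MDiffAt (T% Y) x) :
    MDiffAt (fun y ↦ h y (X y) (Y y)) x := by
  have := MDifferentiableAt.clm_bundle_apply₂ (F₁ := E) (F₂ := E) (F₃ := ℝ)
    (E₁ := fun x : M ↦ TangentSpace I x) (E₂ := fun x : M ↦ TangentSpace I x)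
    (E₃ := Bundle.Trivial M ℝ) (b := id) (hh.smooth.mdifferentiable (by simp) x) hX hY
  rw [mdifferentiableAt_totalSpace] at this
  exact this.2

theorem tensorialAt_covDeriv_left (hh : IsSmoothSymmetric I h) {Z Y : Π x : M, TangentSpace I x}
    {x : M} (hY : MDiffAt (T% Y) x) : TensorialAt I E (fun X ↦ covDeriv I h Z X Y x) x where
  smul {f X} hf hX := by
    have e : (fun y ↦ h y ((f • X) y) (Y y)) = f * fun y ↦ h y (X y) (Y y) := by ext y; simp
    have := cov_smul_right (X := Z) hf hX
    simp only [cov] at this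
    simp only [covDeriv, e, mvfderiv_mul hf (hh.mdiffAt_apply hX hY), this]
    simp
    ring
  add {X X'} hX hX' := by
    have e : (fun y ↦ h y ((X + X') y) (Y y)) =
      (fun y ↦ h y (X y) (Y y)) + fun y ↦ h y (X' y) (Y y) := by ext y; simp
    have := cov_add_right (X := Z) hX hX'
    simp only [cov] at this
    simp only [covDeriv, e, mvfderiv_add (hh.mdiffAt_apply hX hY) (hh.mdiffAt_apply hX' hY), this]
    simp
    ring

theorem covDeriv_symm (hh : IsSmoothSymmetric I h) (Z X Y : Π x : M, TangentSpace I x) (x : M) :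
    covDeriv I h Z X Y x = covDeriv I h Z Y X x := by
  simp only [covDeriv]
  rw [hh.symm x (X x), hh.symm x _ (Y x), show (fun y ↦ h y (X y) (Y y)) =
    fun y ↦ h y (Y y) (X y) from funext fun y ↦ hh.symm y _ _]
  ring

theorem tensorialAt_covDeriv_right (hh : IsSmoothSymmetric I h) {Z X : Π x : M, TangentSpace I x}
    {x : M} (hX : MDiffAt (T% X) x) : TensorialAt I E (fun Y ↦ covDeriv I h Z X Y x) x := by
  simp only [covDeriv_symm hh Z X]
  exact tensorialAt_covDeriv_left hh hX

/-- The covariant derivative `∇h` at `x` as a trilinear form; the direction of differentiation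
comes first. -/
noncomputable def covDerivForm (hh : IsSmoothSymmetric I h) (x : M) :
    TangentSpace I x →ₗ[ℝ] TangentSpace I x →ₗ[ℝ] TangentSpace I x →ₗ[ℝ] ℝ where
  toFun c := ContinuousLinearMap.toLinearMap₁₂
    (TensorialAt.mkHom₂ (fun X Y ↦ covDeriv I h (extend E c) X Y x) x
      (fun _ hY ↦ tensorialAt_covDeriv_left hh hY) (fun _ hX ↦ tensorialAt_covDeriv_right hh hX))
  map_add' c c' := by
    ext a b
    simp [TensorialAt.mkHom₂_apply_eq_extend, covDeriv]
    ring
  map_smul' r c := by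
    ext a b
    simp [TensorialAt.mkHom₂_apply_eq_extend, covDeriv]
    ring

theorem covDerivForm_apply (hh : IsSmoothSymmetric I h) {X Y : Π x : M, TangentSpace I x} {x : M}
    (Z : Π x : M, TangentSpace I x) (hX : MDiffAt (T% X) x) (hY : MDiffAt (T% Y) x) :
    covDerivForm hh x (Z x) (X x) (Y x) = covDeriv I h Z X Y x := by
  have := TensorialAt.mkHom₂_apply (fun _ hY ↦ tensorialAt_covDeriv_left hh hY)
    (fun _ hX ↦ tensorialAt_covDeriv_right hh hX)
    (Φ := fun X Y ↦ covDeriv I h (extend E (Z x)) X Y x)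
    hX hY
  refine Eq.trans this ?_
  simp [covDeriv]

theorem mvfderiv_eq_covDeriv (Z X Y : Π x : M, TangentSpace I x) (x : M) :
    mvfderiv I (fun y ↦ h y (X y) (Y y)) x (Z x) =
      covDeriv I h Z X Y x + h x (cov I Z X x) (Y x) + h x (X x) (cov I Z Y x) := by
  simp only [covDeriv, cov]
  ring

theorem Gauss.apply (hG : Gauss I h) {V W X Y : Π x : M, TangentSpace I x} {x : M}
    (hW : CMDiffAt ∞ (T% W) x) (hX : CMDiffAt ∞ (T% X) x) (hY : CMDiffAt ∞ (T% Y) x) :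
    ⟪curvatureField I X Y W x, V x⟫_ℝ =
      h x (V x) (X x) * h x (W x) (Y x) - h x (V x) (Y x) * h x (W x) (X x) := by
  rw [← riemann_apply hW hX hY, hG]

/-- The derivative of the Gauss equation: the pairing of `V` with `(∇_Z R)(X, Y) W`. -/
theorem Gauss.differentiate (hh : IsSmoothSymmetric I h) (hG : Gauss I h)
    {V W X Y Z : Π x : M, TangentSpace I x} {x : M}
    (hV : ∀ᶠ y in 𝓝 x, CMDiffAt ∞ (T% V) y) (hW : ∀ᶠ y in 𝓝 x, CMDiffAt ∞ (T% W) y)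
    (hX : ∀ᶠ y in 𝓝 x, CMDiffAt ∞ (T% X) y) (hY : ∀ᶠ y in 𝓝 x, CMDiffAt ∞ (T% Y) y)
    (hZ : ∀ᶠ y in 𝓝 x, CMDiffAt ∞ (T% Z) y) :
    ⟪(cov I Z (curvatureField I X Y W) - curvatureField I X Y (cov I Z W)
        - curvatureField I (cov I Z X) Y W - curvatureField I X (cov I Z Y) W) x, V x⟫_ℝ =
      covDeriv I h Z V X x * h x (W x) (Y x) + h x (V x) (X x) * covDeriv I h Z W Y x
        - covDeriv I h Z V Y x * h x (W x) (X x) - h x (V x) (Y x) * covDeriv I h Z W X x := by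
  have m {Z : Π x : M, TangentSpace I x} (h : ∀ᶠ y in 𝓝 x, CMDiffAt ∞ (T% Z) y) :=
    mdiffAt_of_contMDiffAt h.self_of_nhds
  have e : (fun y ↦ ⟪curvatureField I X Y W y, V y⟫_ℝ) =ᶠ[𝓝 x]
      ((fun y ↦ h y (V y) (X y)) * fun y ↦ h y (W y) (Y y))
        - (fun y ↦ h y (V y) (Y y)) * fun y ↦ h y (W y) (X y) := by
    filter_upwards [hW, hX, hY] with y hW hX hY using hG.apply hW hX hY
  have key := congrArg (fun L ↦ L (Z x)) (mvfderiv_congr (I := I) e)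
  have d1 := hh.mdiffAt_apply (m hV) (m hX)
  have d2 := hh.mdiffAt_apply (m hW) (m hY)
  have d3 := hh.mdiffAt_apply (m hV) (m hY)
  have d4 := hh.mdiffAt_apply (m hW) (m hX)
  simp only [mvfderiv_sub (d1.mul d2) (d3.mul d4), mvfderiv_mul d1 d2, mvfderiv_mul d3 d4] at key
  replace hX := hX.self_of_nhds
  replace hY := hY.self_of_nhds
  replace hZ := hZ.self_of_nhds
  replace hW := hW.self_of_nhds
  replace hV := hV.self_of_nhds
  rw [mvfderiv_inner (mdiffAt_of_contMDiffAt (contMDiffAt_curvatureField hX hY hW))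
    (mdiffAt_of_contMDiffAt hV)] at key
  simp only [sub_apply, add_apply, smul_apply, mvfderiv_eq_covDeriv, hG.apply hW hX hY,
    smul_eq_mul] at key
  simp only [Pi.sub_apply, inner_sub_left, hG.apply (contMDiffAt_cov hZ hW) hX hY,
    hG.apply hW (contMDiffAt_cov hZ hX) hY, hG.apply hW hX (contMDiffAt_cov hZ hY)]
  linear_combination key

theorem eventually_contMDiffAt_extend {x : M} (v : TangentSpace I x) :
    ∀ᶠ y in 𝓝 x, CMDiffAt ∞ (T% (extend E v)) y := by
  obtain ⟨s, hs, h⟩ := exists_contMDiffOn_extend (k := ∞) I E v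
  filter_upwards [eventually_mem_nhds_iff.2 hs] with y hy using h.contMDiffAt hy

theorem Gauss.pos (hG : Gauss I h) (hsec : PositiveSectionalCurvature I M) {x : M}
    {u v : TangentSpace I x} (huv : LinearIndependent ℝ ![u, v]) :
    0 < h x u u * h x v v - h x u v * h x v u := by
  have h1 := hsec x u v huv
  rw [sectionalCurvature] at h1
  -- by Cauchy-Schwarz, a positive quotient by the Gram determinant has a positive numerator
  have h2 : 0 ≤ ⟪u, u⟫_ℝ * ⟪v, v⟫_ℝ - ⟪u, v⟫_ℝ ^ 2 := by
    have := real_inner_mul_inner_self_le u v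
    linarith [sq ⟪u, v⟫_ℝ]
  rw [← hG]
  by_contra! h3
  exact absurd h1 (not_lt.2 (div_nonpos_of_nonpos_of_nonneg h3 h2))

theorem Gauss.codazzi (hn : 3 < finrank ℝ E) (hsec : PositiveSectionalCurvature I M)
    (hh : IsSmoothSymmetric I h) (hG : Gauss I h) : Codazzi I h := by
  intro x X Y Z hX hY hZ
  rw [← covDerivForm_apply hh Z hX hY, ← covDerivForm_apply hh Y hX hZ]
  have hn' : 3 < finrank ℝ (TangentSpace I x) := hn
  refine codazzi_of_differentiated_gauss (V := TangentSpace I x)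
    (h := ContinuousLinearMap.toLinearMap₁₂ (h x)) hn'
    (fun u v ↦ hh.symm x u v) (fun u v huv ↦ hG.pos hsec huv) (covDerivForm hh x) ?_ _ _ _
  intro a b c d e
  have s (v : TangentSpace I x) := eventually_contMDiffAt_extend v
  have m (v : TangentSpace I x) := mdiffAt_of_contMDiffAt (s v).self_of_nhds
  have D (u v w : TangentSpace I x) : covDerivForm hh x u v w =
      covDeriv I h (extend E u) (extend E v) (extend E w) x := by
    simpa using covDerivForm_apply hh (extend E u) (m v) (m w)
  have B := second_bianchi (s e).self_of_nhds (s c).self_of_nhds (s d).self_of_nhds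
    (s b).self_of_nhds
  replace B := congrArg (fun v ↦ ⟪v, extend E a x⟫_ℝ) B
  simp only [Pi.add_apply, inner_add_left, inner_zero_left] at B
  rw [hG.differentiate hh (s a) (s b) (s c) (s d) (s e),
    hG.differentiate hh (s a) (s b) (s d) (s e) (s c),
    hG.differentiate hh (s a) (s b) (s e) (s c) (s d)] at B
  simp only [extend_apply_self] at B
  simp only [D]
  exact B

end Geometric

end Hypersurface

namespace Hypersurface

open Matrix NormedSpace

/-! ### The exponential of the second compound -/

section MatrixLog

theorem exp_cfc_log {m : Type*} [Fintype m] [DecidableEq m] {A : Matrix m m ℝ} (hA : A.PosDef) :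
    exp (cfc Real.log A) = A := by
  have h := hA.isHermitian
  rw [h.cfc_eq, IsHermitian.cfc]
  conv_rhs => rw [h.spectral_theorem]
  simp only [Unitary.conjStarAlgAut_apply]
  have hU : (star h.eigenvectorUnitary : Matrix m m ℝ) = (h.eigenvectorUnitary : Matrix m m ℝ)⁻¹ :=
    (Matrix.inv_eq_right_inv (Unitary.coe_mul_star_self _)).symm
  rw [hU, Matrix.exp_conj _ _ (Unitary.isUnit_coe), Matrix.exp_diagonal]
  congr 3
  ext i
  rw [Pi.coe_exp]
  simp [← Real.exp_eq_exp_ℝ, Real.exp_log (hA.eigenvalues_pos i)]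

end MatrixLog

section MatrixExp

open scoped Matrix.Norms.Operator Kronecker

variable {m n : Type*} [Fintype m] [DecidableEq m] [Fintype n] [DecidableEq n]

theorem exp_mul_of_intertwine {A : Matrix m m ℝ} {B : Matrix n n ℝ} {W : Matrix m n ℝ}
    (h : A * W = W * B) : exp A * W = W * exp B := by
  have pow (k : ℕ) : A ^ k * W = W * B ^ k := by
    induction k with
    | zero => simp
    | succ k ih => rw [pow_succ', Matrix.mul_assoc, ih, ← Matrix.mul_assoc, h, Matrix.mul_assoc,
        ← pow_succ']
  have hA := (exp_series_hasSum_exp' (𝕂 := ℝ) A).map (AddMonoidHom.mk' (· * W)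
    fun _ _ ↦ Matrix.add_mul ..) (continuous_id.matrix_mul continuous_const)
  have hB := (exp_series_hasSum_exp' (𝕂 := ℝ) B).map (AddMonoidHom.mk' (W * ·)
    fun _ _ ↦ Matrix.mul_add ..) (continuous_const.matrix_mul continuous_id)
  refine hA.unique ?_
  convert! hB using 1
  ext1 k
  simp [pow]

theorem exp_kronecker_one (A : Matrix m m ℝ) :
    exp (A ⊗ₖ (1 : Matrix n n ℝ)) = exp A ⊗ₖ (1 : Matrix n n ℝ) := by
  let f : Matrix m m ℝ →+* Matrix (m × n) (m × n) ℝ :=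
    { toFun := fun A ↦ A ⊗ₖ 1
      map_one' := one_kronecker_one
      map_mul' := fun A B ↦ by simp [← mul_kronecker_mul]
      map_zero' := zero_kronecker _
      map_add' := fun A B ↦ add_kronecker .. }
  have hf : Continuous f := by
    refine continuous_matrix fun i j ↦ ?_
    exact (continuous_id.matrix_elem _ _).mul continuous_const
  exact (map_exp f hf A).symm

theorem exp_one_kronecker (A : Matrix m m ℝ) :
    exp ((1 : Matrix n n ℝ) ⊗ₖ A) = (1 : Matrix n n ℝ) ⊗ₖ exp A := by
  let f : Matrix m m ℝ →+* Matrix (n × m) (n × m) ℝ :=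
    { toFun := fun A ↦ 1 ⊗ₖ A
      map_one' := one_kronecker_one
      map_mul' := fun A B ↦ by simp [← mul_kronecker_mul]
      map_zero' := kronecker_zero _
      map_add' := fun A B ↦ kronecker_add .. }
  have hf : Continuous f := by
    refine continuous_matrix fun i j ↦ ?_
    exact continuous_const.mul (continuous_id.matrix_elem _ _)
  exact (map_exp f hf A).symm

theorem exp_kronecker_add (A : Matrix m m ℝ) :
    exp (A ⊗ₖ (1 : Matrix m m ℝ) + (1 : Matrix m m ℝ) ⊗ₖ A) = exp A ⊗ₖ exp A := by
  rw [Matrix.exp_add_of_commute, exp_kronecker_one, exp_one_kronecker, ← mul_kronecker_mul,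
    Matrix.mul_one, Matrix.one_mul]
  simp [Commute, SemiconjBy, ← mul_kronecker_mul]

theorem posDef_exp {A : Matrix m m ℝ} (hA : A.IsHermitian) : (exp A).PosDef := by
  have h : exp A = (exp ((2⁻¹ : ℝ) • A))ᴴ * exp ((2⁻¹ : ℝ) • A) := by
    have hh : ((2⁻¹ : ℝ) • A).IsHermitian := by
      rw [IsHermitian, conjTranspose_smul, hA.eq, star_trivial]
    rw [hh.exp.eq, ← Matrix.exp_add_of_commute _ _ (Commute.refl _), ← add_smul]
    norm_num
  rw [h]
  exact Matrix.PosDef.conjTranspose_mul_self _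
    (Matrix.mulVec_injective_of_isUnit (Matrix.isUnit_exp _))

/-- The inclusion of the second exterior power into the tensor square, in the bases
`e i ∧ e j`, `i < j`, and `e i ⊗ e j`. -/
def wedgeInclusion (m : Type*) [DecidableEq m] [LT m] :
    Matrix (m × m) {p : m × m // p.1 < p.2} ℝ :=
  of fun a q ↦ (1 : Matrix (m × m) (m × m) ℝ) a q.1 - (1 : Matrix (m × m) (m × m) ℝ) a q.1.swap

theorem kronecker_mul_wedgeInclusion [LT m]
    (X Y : Matrix m m ℝ) (a b : m) (q : {p : m × m // p.1 < p.2}) :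
    ((X ⊗ₖ Y) * wedgeInclusion m) (a, b) q =
      X a q.1.1 * Y b q.1.2 - X a q.1.2 * Y b q.1.1 := by
  simp [mul_apply, wedgeInclusion, one_apply, mul_sub, Finset.sum_sub_distrib]

theorem wedgeInclusion_mul [LinearOrder m] [Fintype {p : m × m // p.1 < p.2}]
    (L : Matrix {p : m × m // p.1 < p.2} {p : m × m // p.1 < p.2} ℝ)
    (p q : {p : m × m // p.1 < p.2}) : (wedgeInclusion m * L) p.1 q = L p q := by
  rw [mul_apply, Finset.sum_eq_single p]
  · have : p.1 ≠ p.1.swap := fun h ↦ p.2.ne (congrArg Prod.fst h)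
    simp [wedgeInclusion, one_apply, this]
  · intro r _ hr
    have h1 : p.1 ≠ r.1 := fun h ↦ hr (Subtype.ext h.symm)
    have h2 : p.1 ≠ r.1.swap := fun h ↦ by
      have h3 := p.2
      rw [h] at h3
      exact lt_asymm r.2 h3
    simp [wedgeInclusion, one_apply, h1, h2]
  · simp

theorem wedgeInclusion_mul_swap [LT m] [Fintype {p : m × m // p.1 < p.2}]
    (L : Matrix {p : m × m // p.1 < p.2} {p : m × m // p.1 < p.2} ℝ)
    (a b : m) (q : {p : m × m // p.1 < p.2}) :
    (wedgeInclusion m * L) (b, a) q = -(wedgeInclusion m * L) (a, b) q := by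
  have (r : m × m) : (b, a) = r ↔ (a, b) = r.swap := by
    simp [Prod.ext_iff, and_comm]
  rw [mul_apply, mul_apply, ← Finset.sum_neg_distrib]
  refine Finset.sum_congr rfl fun r _ ↦ ?_
  simp only [wedgeInclusion, of_apply, one_apply, this, Prod.swap_swap]
  ring

/-- If `L` is the derivation extension of `P` to the second exterior power, in the basis
`e i ∧ e j`, `i < j`, then the entries of `exp L` are the `2 × 2` minors of `exp P`. Indeed the
inclusion `W` of the exterior power into the tensor square intertwines `L` with `P ⊗ 1 + 1 ⊗ P`,
whose exponential is `exp P ⊗ exp P`. -/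
theorem exp_derivation_eq_minor [LinearOrder m] [Fintype {p : m × m // p.1 < p.2}]
    {P : Matrix m m ℝ}
    {L : Matrix {p : m × m // p.1 < p.2} {p : m × m // p.1 < p.2} ℝ}
    (hL : ∀ p q, L p q = (1 : Matrix m m ℝ) p.1.1 q.1.1 * P p.1.2 q.1.2
      + P p.1.1 q.1.1 * (1 : Matrix m m ℝ) p.1.2 q.1.2
      - P p.1.1 q.1.2 * (1 : Matrix m m ℝ) p.1.2 q.1.1
      - (1 : Matrix m m ℝ) p.1.1 q.1.2 * P p.1.2 q.1.1)
    (p q : {p : m × m // p.1 < p.2}) :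
    exp L p q = exp P p.1.1 q.1.1 * exp P p.1.2 q.1.2 - exp P p.1.1 q.1.2 * exp P p.1.2 q.1.1 := by
  have key : (P ⊗ₖ (1 : Matrix m m ℝ) + (1 : Matrix m m ℝ) ⊗ₖ P) * wedgeInclusion m =
      wedgeInclusion m * L := by
    ext ⟨a, b⟩ q
    rw [Matrix.add_mul, Matrix.add_apply, kronecker_mul_wedgeInclusion,
      kronecker_mul_wedgeInclusion]
    rcases lt_trichotomy a b with h | h | h
    · rw [wedgeInclusion_mul L ⟨(a, b), h⟩ q, hL]
      ring
    · subst h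
      have := wedgeInclusion_mul_swap L a a q
      linarith
    · rw [wedgeInclusion_mul_swap, wedgeInclusion_mul L ⟨(b, a), h⟩ q, hL]
      ring
  rw [← wedgeInclusion_mul (exp L) p q, ← exp_mul_of_intertwine key, exp_kronecker_add,
    kronecker_mul_wedgeInclusion]

end MatrixExp

end Hypersurface

namespace Hypersurface

open Matrix NormedSpace

/-! ### The Gauss equation for the exponential of the Schouten component -/

section Pointwise

variable {V : Type*} [NormedAddCommGroup V] [InnerProductSpace ℝ V] [FiniteDimensional ℝ V]

local notation "𝖾" => stdOrthonormalBasis ℝ V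

theorem inner_stdOrthonormalBasis (i j : Fin (finrank ℝ V)) :
    ⟪𝖾 i, 𝖾 j⟫_ℝ = (1 : Matrix (Fin (finrank ℝ V)) (Fin (finrank ℝ V)) ℝ) i j := by
  rw [(𝖾).inner_eq_ite, one_apply]

theorem wedgeCoord_basis (p : PairIndex V) :
    wedgeCoord (𝖾 p.1.1) (𝖾 p.1.2) = Pi.single p 1 := by
  ext q
  simp only [wedgeCoord, inner_stdOrthonormalBasis, one_apply, Pi.single_apply]
  have hp := p.2
  have hq := q.2
  by_cases h : q = p
  · subst h
    simp [hq.ne, hq.ne']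
  · have h1 : ¬ (q.1.1 = p.1.1 ∧ q.1.2 = p.1.2) := fun h' ↦ h (Subtype.ext (Prod.ext h'.1 h'.2))
    have h2 : ¬ (q.1.2 = p.1.1 ∧ q.1.1 = p.1.2) := fun h' ↦ by
      rw [← h'.1, ← h'.2] at hp
      exact lt_asymm hp hq
    simp only [h, if_false, mul_ite, mul_one, mul_zero, ← ite_and]
    rw [if_neg (by tauto), if_neg (by tauto), sub_zero]

theorem logTensor_basis (R : V → V → V → V → ℝ) (p q : PairIndex V) :
    logTensor R (𝖾 p.1.1) (𝖾 p.1.2) (𝖾 q.1.1) (𝖾 q.1.2) = cfc Real.log (operatorMatrix R) p q := by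
  rw [logTensor, wedgeCoord_basis, wedgeCoord_basis]
  simp

theorem logTensor_pair_symm (R : V → V → V → V → ℝ) (a b c d : V) :
    logTensor R a b c d = logTensor R c d a b := by
  have h : (cfc Real.log (operatorMatrix R))ᵀ = cfc Real.log (operatorMatrix R) := by
    have : IsSelfAdjoint (cfc Real.log (operatorMatrix R)) := cfc_predicate _ _
    rwa [isSelfAdjoint_iff, star_eq_conjTranspose, conjTranspose_eq_transpose_of_trivial] at this
  simp only [logTensor]
  rw [dotProduct_mulVec, ← mulVec_transpose, h, dotProduct_comm]

theorem schouten_symm {R : V → V → V → V → ℝ} (h : ∀ a b c d, R a b c d = R c d a b) (a b : V) :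
    schouten R a b = schouten R b a := by
  have : ricci R a b = ricci R b a := Finset.sum_congr rfl fun i _ ↦ h ..
  simp only [schouten, this, real_inner_comm]

/-- The matrix of the Schouten component in the standard orthonormal basis. -/
noncomputable def schoutenMatrix (R : V → V → V → V → ℝ) :
    Matrix (Fin (finrank ℝ V)) (Fin (finrank ℝ V)) ℝ :=
  of fun i j ↦ schouten R (𝖾 i) (𝖾 j)

theorem expForm_apply (R : V → V → V → V → ℝ) (u v : V) :
    expForm (schouten R) u v =
      (fun i ↦ ⟪𝖾 i, u⟫_ℝ) ⬝ᵥ exp (schoutenMatrix R) *ᵥ (fun i ↦ ⟪𝖾 i, v⟫_ℝ) := by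
  simp only [expForm, _root_.sum_apply, dotProduct, mulVec, Finset.mul_sum, schoutenMatrix]
  refine Finset.sum_congr rfl fun i _ ↦ Finset.sum_congr rfl fun j _ ↦ ?_
  simp
  ring

theorem expForm_basis (R : V → V → V → V → ℝ) (i j : Fin (finrank ℝ V)) :
    expForm (schouten R) (𝖾 i) (𝖾 j) = exp (schoutenMatrix R) i j := by
  have h (i : Fin (finrank ℝ V)) : (fun k ↦ ⟪𝖾 k, 𝖾 i⟫_ℝ) = Pi.single i 1 := by
    ext k
    rw [(𝖾).inner_eq_ite, Pi.single_apply]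
  rw [expForm_apply, h, h]
  simp

theorem posDef_exp_schoutenMatrix {R : V → V → V → V → ℝ}
    (h : ∀ a b c d, R a b c d = R c d a b) : (exp (schoutenMatrix R)).PosDef :=
  posDef_exp (by ext i j; simp [schoutenMatrix, schouten_symm h (𝖾 i) (𝖾 j)])

theorem expForm_symm {R : V → V → V → V → ℝ}
    (h : ∀ a b c d, R a b c d = R c d a b) (u v : V) :
    expForm (schouten R) u v = expForm (schouten R) v u := by
  have := (posDef_exp_schoutenMatrix h).isHermitian
  rw [IsHermitian, conjTranspose_eq_transpose_of_trivial] at this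
  rw [expForm_apply, expForm_apply, dotProduct_mulVec, ← mulVec_transpose, this, dotProduct_comm]

theorem expForm_pos {R : V → V → V → V → ℝ}
    (h : ∀ a b c d, R a b c d = R c d a b) {u : V} (hu : u ≠ 0) :
    0 < expForm (schouten R) u u := by
  rw [expForm_apply]
  have := (posDef_exp_schoutenMatrix h).dotProduct_mulVec_pos (x := fun i ↦ ⟪𝖾 i, u⟫_ℝ) (by
    intro h0
    refine hu (InnerProductSpace.ext_inner_left_basis (𝕜 := ℝ) (𝖾).toBasis fun i ↦ ?_)
    simpa using congrFun h0 i)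
  simpa using this

/-- The linearity and antisymmetry properties of the curvature tensor from which linearity in all
slots follows. -/
structure IsCurvatureLike (R : V → V → V → V → ℝ) : Prop where
  add_fst : ∀ a a' b c d, R (a + a') b c d = R a b c d + R a' b c d
  smul_fst : ∀ (r : ℝ) a b c d, R (r • a) b c d = r * R a b c d
  add_trd : ∀ a b c c' d, R a b (c + c') d = R a b c d + R a b c' d
  smul_trd : ∀ (r : ℝ) a b c d, R a b (r • c) d = r * R a b c d
  swap_left : ∀ a b c d, R b a c d = -R a b c d
  swap_right : ∀ a b c d, R a b d c = -R a b c d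

/-- Curvature-like tensors are determined by the matrix of their operator on bivectors. -/
theorem IsCurvatureLike.ext {R S : V → V → V → V → ℝ} (hR : IsCurvatureLike R)
    (hS : IsCurvatureLike S)
    (h : ∀ p q : PairIndex V, R (𝖾 p.1.1) (𝖾 p.1.2) (𝖾 q.1.1) (𝖾 q.1.2) =
      S (𝖾 p.1.1) (𝖾 p.1.2) (𝖾 q.1.1) (𝖾 q.1.2)) (a b c d : V) :
    R a b c d = S a b c d := by
  have lin {f g : V → ℝ} (hf : ∀ x y, f (x + y) = f x + f y)
      (hf' : ∀ (r : ℝ) x, f (r • x) = r * f x)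
      (hg : ∀ x y, g (x + y) = g x + g y) (hg' : ∀ (r : ℝ) x, g (r • x) = r * g x)
      (hfg : ∀ i, f (𝖾 i) = g (𝖾 i)) (x : V) : f x = g x := by
    have : (⟨⟨f, hf⟩, hf'⟩ : V →ₗ[ℝ] ℝ) = ⟨⟨g, hg⟩, hg'⟩ :=
      (𝖾).toBasis.ext fun i ↦ by simpa using hfg i
    exact congrArg (fun L : V →ₗ[ℝ] ℝ ↦ L x) this
  have diag_left {R : V → V → V → V → ℝ} (hR : IsCurvatureLike R) (a c d : V) :
      R a a c d = 0 := by linarith [hR.swap_left a a c d]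
  have diag_right {R : V → V → V → V → ℝ} (hR : IsCurvatureLike R) (a b c : V) :
      R a b c c = 0 := by linarith [hR.swap_right a b c c]
  have basis_right (p : PairIndex V) (k l : Fin (finrank ℝ V)) :
      R (𝖾 p.1.1) (𝖾 p.1.2) (𝖾 k) (𝖾 l) = S (𝖾 p.1.1) (𝖾 p.1.2) (𝖾 k) (𝖾 l) := by
    rcases lt_trichotomy k l with hkl | rfl | hkl
    · exact h p ⟨(k, l), hkl⟩
    · rw [diag_right hR, diag_right hS]
    · rw [hR.swap_right _ _ (𝖾 l), hS.swap_right _ _ (𝖾 l)]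
      exact congrArg _ (h p ⟨(l, k), hkl⟩)
  have basis (i j k l : Fin (finrank ℝ V)) :
      R (𝖾 i) (𝖾 j) (𝖾 k) (𝖾 l) = S (𝖾 i) (𝖾 j) (𝖾 k) (𝖾 l) := by
    rcases lt_trichotomy i j with hij | rfl | hij
    · exact basis_right ⟨(i, j), hij⟩ k l
    · rw [diag_left hR, diag_left hS]
    · rw [hR.swap_left (𝖾 j), hS.swap_left (𝖾 j)]
      exact congrArg _ (basis_right ⟨(j, i), hij⟩ k l)
  have fst (b : V) {c d : V} (hb : ∀ i, R (𝖾 i) b c d = S (𝖾 i) b c d) (a : V) :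
      R a b c d = S a b c d :=
    lin (f := fun a ↦ R a b c d) (g := fun a ↦ S a b c d) (fun _ _ ↦ hR.add_fst ..)
      (fun _ _ ↦ hR.smul_fst ..) (fun _ _ ↦ hS.add_fst ..) (fun _ _ ↦ hS.smul_fst ..) hb a
  have trd {a b d : V} (hb : ∀ i, R a b (𝖾 i) d = S a b (𝖾 i) d) (c : V) :
      R a b c d = S a b c d :=
    lin (f := fun c ↦ R a b c d) (g := fun c ↦ S a b c d) (fun _ _ ↦ hR.add_trd ..)
      (fun _ _ ↦ hR.smul_trd ..) (fun _ _ ↦ hS.add_trd ..) (fun _ _ ↦ hS.smul_trd ..) hb c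
  have flip_left {a b c d : V} (h : R a b c d = S a b c d) : R b a c d = S b a c d := by
    rw [hR.swap_left a, hS.swap_left a, h]
  have flip_right {a b c d : V} (h : R a b c d = S a b c d) : R a b d c = S a b d c := by
    rw [hR.swap_right _ _ c, hS.swap_right _ _ c, h]
  exact fst _ (fun i ↦ flip_left <| fst _ (fun j ↦ flip_left <| trd (fun k ↦ flip_right <|
    trd (fun l ↦ flip_right <| basis i j k l) d) c) b) a

theorem isCurvatureLike_minor (B : V →L[ℝ] V →L[ℝ] ℝ) :
    IsCurvatureLike fun a b c d ↦ B a c * B b d - B a d * B b c where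
  add_fst a a' b c d := by simp; ring
  smul_fst r a b c d := by simp; ring
  add_trd a b c c' d := by simp; ring
  smul_trd r a b c d := by simp; ring
  swap_left a b c d := by ring
  swap_right a b c d := by ring

/-- If the Weyl component of `logTensor R` vanishes, then the exponential of the Schouten component
of `logTensor R` satisfies the Gauss equation for `R`. -/
theorem eq_minor_expForm {R : V → V → V → V → ℝ} (hR : IsCurvatureLike R)
    (hpos : (operatorMatrix R).PosDef) (hw : ∀ a b c d, weyl (logTensor R) a b c d = 0)
    (a b c d : V) :
    R a b c d = expForm (schouten (logTensor R)) a c * expForm (schouten (logTensor R)) b d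
      - expForm (schouten (logTensor R)) a d * expForm (schouten (logTensor R)) b c := by
  refine hR.ext (isCurvatureLike_minor _) (fun p q ↦ ?_) a b c d
  simp only [expForm_basis]
  have hL := exp_derivation_eq_minor (P := schoutenMatrix (logTensor R))
    (L := cfc Real.log (operatorMatrix R)) (fun p q ↦ by
      have := hw (𝖾 p.1.1) (𝖾 p.1.2) (𝖾 q.1.1) (𝖾 q.1.2)
      rw [weyl, logTensor_basis, sub_eq_zero] at this
      simpa only [inner_stdOrthonormalBasis, schoutenMatrix, of_apply] using this) p q
  rw [exp_cfc_log hpos] at hL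
  exact hL

end Pointwise

end Hypersurface

namespace Hypersurface

open Filter Topology

/-! ### Smoothness of positive definite solutions of the Gauss equation -/

section Pointwise

variable {V : Type*} [AddCommGroup V]

/-- The determinant of the restriction of the curvature operator `R` to the span of the bivectors
`u ∧ v`, `u ∧ w`, `v ∧ w`. -/
def spanDet (R : V → V → V → V → ℝ) (u v w : V) : ℝ :=
  !![R u v u v, R u v u w, R u v v w;
     R u v u w, R u w u w, R u w v w;
     R u v v w, R u w v w, R v w v w].det

/-- A positive definite solution `B` of the Gauss equation is recovered from `R`: with `D` the Gram
determinant of `u, v, w` for `B`, the numerator is `B u u * D`, and `spanDet R u v w = D ^ 2` since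
the second compound of a `3 × 3` matrix has as determinant the square of the determinant. -/
theorem apply_self_eq_div_sqrt_spanDet [Module ℝ V] {B : LinearMap.BilinForm ℝ V}
    {R : V → V → V → V → ℝ} (hs : ∀ a b, B a b = B b a) (hB : ∀ a, a ≠ 0 → 0 < B a a)
    (hR : ∀ a b c d, R a b c d = B a c * B b d - B a d * B b c)
    (hpos : ∀ a b, LinearIndependent ℝ ![a, b] → 0 < B a a * B b b - B a b * B b a)
    {u v w : V} (hli : LinearIndependent ℝ ![u, v, w]) :
    0 < spanDet R u v w ∧
      B u u = (R u v u v * R u w u w - R u v u w ^ 2) / √(spanDet R u v w) := by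
  rw [Fintype.linearIndependent_iff] at hli
  have huv : LinearIndependent ℝ ![u, v] := by
    rw [LinearIndependent.pair_iff]
    intro s t hst
    have := hli ![s, t, 0] (by simpa [Fin.sum_univ_three] using hst)
    exact ⟨this 0, this 1⟩
  have hu : u ≠ 0 := by
    rintro rfl
    simpa using hli ![1, 0, 0] (by simp [Fin.sum_univ_three]) 0
  have hp := hpos u v huv
  set p := B u u * B v v - B u v * B v u with hpdef
  set q := B u u * B v w - B u w * B v u with hqdef
  -- `z` is chosen so that `R u z u z` is `p` times the Gram determinant of `u ∧ v` and `u ∧ w`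
  have hz : LinearIndependent ℝ ![u, p • w - q • v] := by
    rw [LinearIndependent.pair_iff]
    intro s t hst
    have := hli ![s, -(t * q), t * p] (by
      rw [← hst]
      simp only [Fin.sum_univ_three, Matrix.cons_val]
      module)
    have h0 : s = 0 := this 0
    have h2 : t * p = 0 := this 2
    exact ⟨h0, (mul_eq_zero.1 h2).resolve_right hp.ne'⟩
  have hq := hpos u _ hz
  have hu' := hB u hu
  have s1 := hs v u
  have s2 := hs w u
  have s3 := hs w v
  set D := B u u * B v v * B w w + 2 * B u v * B u w * B v w - B u u * B v w ^ 2
    - B v v * B u w ^ 2 - B w w * B u v ^ 2 with hD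
  have e : B u u * B (p • w - q • v) (p • w - q • v)
      - B u (p • w - q • v) * B (p • w - q • v) u = p * (B u u * D) := by
    simp only [map_sub, map_smul, LinearMap.sub_apply, LinearMap.smul_apply, smul_eq_mul, s1, s2,
      s3, hpdef, hqdef, hD]
    ring
  have hD0 : 0 < D := by
    rw [e] at hq
    exact pos_of_mul_pos_right (pos_of_mul_pos_right hq hp.le) hu'.le
  have hK : spanDet R u v w = D ^ 2 := by
    simp only [spanDet, Matrix.det_fin_three, hR, s1, s2, s3, hD, Matrix.of_apply,
      Matrix.cons_val]
    ring
  refine ⟨by rw [hK]; positivity, ?_⟩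
  rw [hK, Real.sqrt_sq hD0.le, eq_div_iff hD0.ne']
  simp only [hR, s1, s2, hD]
  ring

end Pointwise

section Geometric

variable {E : Type*} [NormedAddCommGroup E] [NormedSpace ℝ E]
  {H : Type*} [TopologicalSpace H] {I : ModelWithCorners ℝ E H}
  {M : Type*} [TopologicalSpace M] [ChartedSpace H M]

theorem contMDiffAt_of_forall_apply {F : Type*} [NormedAddCommGroup F] [NormedSpace ℝ F]
    {G : Type*} [NormedAddCommGroup G] [NormedSpace ℝ G] [FiniteDimensional ℝ F]
    {Φ : M → F →L[ℝ] G} {x : M} (h : ∀ v, CMDiffAt ∞ (fun y ↦ Φ y v) x) : CMDiffAt ∞ Φ x := by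
  let b := Module.finBasis ℝ F
  let c (i) : F →L[ℝ] ℝ := LinearMap.toContinuousLinearMap (b.coord i)
  have e : Φ = fun y ↦ ∑ i, ContinuousLinearMap.smulRightL ℝ F G (c i) (Φ y (b i)) := by
    ext y v
    conv_lhs => rw [← b.sum_repr v, map_sum]
    simp [c]
  rw [e]
  exact ContMDiffAt.sum fun i _ ↦
    (ContinuousLinearMap.contMDiff (ContinuousLinearMap.smulRightL ℝ F G (c i))).contMDiffAt.comp x
      (h (b i))

variable [FiniteDimensional ℝ E] [IsManifold I ∞ M]

/-- The extensions of vectors at `x` to vector fields are, near `x`, a linear isomorphism between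
tangent spaces applied to the vectors. -/
theorem eventually_extend_eq (x : M) : ∀ᶠ y in 𝓝 x,
    ∃ L : TangentSpace I x ≃ₗ[ℝ] TangentSpace I y, ∀ v : TangentSpace I x, extend E v y = L v := by
  let t := trivializationAt E (TangentSpace I : M → Type _) x
  have hx : x ∈ t.baseSet := mem_baseSet_trivializationAt ..
  filter_upwards [t.open_baseSet.mem_nhds hx] with y hy
  refine ⟨(t.linearEquivAt ℝ x hx).trans (t.linearEquivAt ℝ y hy).symm, fun v ↦ ?_⟩
  simp [extend, t]

/-- A tensor field is smooth at `x` if its coefficients in the frame of extensions of vectors at `x`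
are: these are its coordinates in the trivialization at `x`. -/
theorem contMDiffAt_of_extend {h : Π x : M, TangentSpace I x →L[ℝ] TangentSpace I x →L[ℝ] ℝ}
    {x : M} (hh : ∀ u v : TangentSpace I x,
      CMDiffAt ∞ (fun y ↦ h y (extend E u y) (extend E v y)) x) :
    ContMDiffAt I (I.prod 𝓘(ℝ, E →L[ℝ] E →L[ℝ] ℝ)) ∞
      (fun x ↦ TotalSpace.mk' (E →L[ℝ] E →L[ℝ] ℝ) x (h x)) x := by
  rw [contMDiffAt_hom_bundle]
  refine ⟨contMDiffAt_id, contMDiffAt_of_forall_apply fun a ↦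
    contMDiffAt_of_forall_apply fun b ↦ ?_⟩
  let t := trivializationAt E (TangentSpace I : M → Type _) x
  have hx : x ∈ t.baseSet := mem_baseSet_trivializationAt ..
  refine (hh (t.symm x a) (t.symm x b)).congr_of_eventuallyEq ?_
  filter_upwards [t.open_baseSet.mem_nhds hx] with y hy
  refine (inCoordinates_apply_eq₂ hy hy (Set.mem_univ _)).trans ?_
  have e (a : E) : (t ⟨x, t.symm x a⟩).2 = a := by rw [t.apply_mk_symm hx]
  simp only [extend, t] at e ⊢
  simp [e]

variable [RiemannianBundle (fun x : M ↦ TangentSpace I x)]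
  [IsContMDiffRiemannianBundle I ∞ E (fun x : M ↦ TangentSpace I x)]
  {h : Π x : M, TangentSpace I x →L[ℝ] TangentSpace I x →L[ℝ] ℝ}

theorem contMDiffAt_spanDet {x : M} (u v w : TangentSpace I x) :
    CMDiffAt ∞ (fun y ↦ spanDet (riemann I y) (extend E u y) (extend E v y) (extend E w y)) x := by
  have s (v : TangentSpace I x) := eventually_contMDiffAt_extend v
  have R (a b c d : TangentSpace I x) := contMDiffAt_riemann (s a).self_of_nhds (s b) (s c) (s d)
  refine contMDiffAt_det fun i j ↦ ?_
  fin_cases i <;> fin_cases j <;> exact R _ _ _ _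

theorem Gauss.contMDiffAt_extend_self (hn : 2 < finrank ℝ E)
    (hsec : PositiveSectionalCurvature I M) (hs : ∀ (x : M) (u v : TangentSpace I x),
      h x u v = h x v u) (hpos : ∀ (x : M) (u : TangentSpace I x), u ≠ 0 → 0 < h x u u)
    (hG : Gauss I h) {x : M} (u : TangentSpace I x) :
    CMDiffAt ∞ (fun y ↦ h y (extend E u y) (extend E u y)) x := by
  have hn' : 2 < finrank ℝ (TangentSpace I x) := hn
  have hL := eventually_extend_eq (I := I) x
  rcases eq_or_ne u 0 with rfl | hu
  · refine (contMDiffAt_const (c := (0 : ℝ))).congr_of_eventuallyEq ?_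
    filter_upwards [hL] with y ⟨L, hL⟩
    simp [hL]
  obtain ⟨v, huv⟩ := exists_linearIndependent_pair_of_one_lt_finrank (R := ℝ) (by omega) hu
  obtain ⟨w, hw⟩ := exists_linearIndependent_snoc_of_lt_finrank huv hn'
  have hli : LinearIndependent ℝ ![u, v, w] := by
    have e : ![u, v, w] = Fin.snoc ![u, v] w := by ext i; fin_cases i <;> rfl
    rwa [e]
  have key {y : M} {u v w : TangentSpace I y} (hli : LinearIndependent ℝ ![u, v, w]) :=
    apply_self_eq_div_sqrt_spanDet (B := ContinuousLinearMap.toLinearMap₁₂ (h y))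
      (R := riemann I y) (hs y) (hpos y) (hG y) (fun a b hab ↦ hG.pos hsec hab) hli
  have s (v : TangentSpace I x) := eventually_contMDiffAt_extend v
  have R (a b c d : TangentSpace I x) := contMDiffAt_riemann (s a).self_of_nhds (s b) (s c) (s d)
  have hK := contMDiffAt_spanDet u v w
  have hK0 : 0 < spanDet (riemann I x) (extend E u x) (extend E v x) (extend E w x) := by
    simpa using (key hli).1
  have hsq : CMDiffAt ∞ (fun y ↦ √(spanDet (riemann I y) (extend E u y) (extend E v y)
      (extend E w y))) x :=
    (Real.contDiffAt_sqrt hK0.ne').contMDiffAt.comp x hK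
  refine ((((R u v u v).mul (R u w u w)).sub ((R u v u w).pow 2)).div₀ hsq
    (Real.sqrt_pos.2 hK0).ne').congr_of_eventuallyEq ?_
  filter_upwards [hL] with y ⟨L, hL⟩
  refine (key ?_).2
  have e : ![extend E u y, extend E v y, extend E w y] = L ∘ ![u, v, w] := by
    ext i; fin_cases i <;> simp [hL]
  rw [e]
  exact hli.map' L.toLinearMap L.ker

/-- A positive definite solution of the Gauss equation over a smooth metric of positive sectional
curvature is automatically smooth. -/
theorem Gauss.isSmoothSymmetric (hn : 2 < finrank ℝ E)
    (hsec : PositiveSectionalCurvature I M) (hs : ∀ (x : M) (u v : TangentSpace I x),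
      h x u v = h x v u) (hpos : ∀ (x : M) (u : TangentSpace I x), u ≠ 0 → 0 < h x u u)
    (hG : Gauss I h) : IsSmoothSymmetric I h where
  symm := hs
  smooth x := contMDiffAt_of_extend fun u v ↦ by
    have d (u : TangentSpace I x) := hG.contMDiffAt_extend_self hn hsec hs hpos u
    refine ((contMDiffAt_const (c := (2⁻¹ : ℝ))).mul
      (((d (u + v)).sub (d u)).sub (d v))).congr_of_eventuallyEq ?_
    filter_upwards [eventually_extend_eq (I := I) x] with y ⟨L, hL⟩
    simp only [Pi.mul_apply, hL, map_add, add_apply, hs y (L v) (L u)]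
    ring

theorem isCurvatureLike_riemann (x : M) : IsCurvatureLike (riemann I x) where
  add_fst := riemann_add_fst x
  smul_fst := riemann_smul_fst x
  add_trd := riemann_add_trd x
  smul_trd := riemann_smul_trd x
  swap_left := riemann_swap_left x
  swap_right := riemann_swap_right x

theorem gauss_expSchoutenLog (hcurv : PositiveCurvatureOperator I M)
    (hw : ∀ (x : M) (a b c d : TangentSpace I x), weyl (riemannLog I x) a b c d = 0) :
    Gauss I (expSchoutenLog I : (x : M) → _) := fun x a b c d ↦
  eq_minor_expForm (isCurvatureLike_riemann x) (hcurv x) (hw x) a b c d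

end Geometric

end Hypersurface

theorem lemma4p6 {n : ℕ} (hn : 3 < n) {M : Type*} [TopologicalSpace M]
    [ChartedSpace (EuclideanSpace ℝ (Fin n)) M] [IsManifold (𝓡 n) ∞ M]
    [RiemannianBundle (fun x : M ↦ TangentSpace (𝓡 n) x)]
    [IsContMDiffRiemannianBundle (𝓡 n) ∞ (EuclideanSpace ℝ (Fin n))
      (fun x : M ↦ TangentSpace (𝓡 n) x)]
    (hsec : Hypersurface.PositiveSectionalCurvature (𝓡 n) M) :
    (Hypersurface.PositiveCurvatureOperator (𝓡 n) M →
      (∀ (x : M) (a b c d : TangentSpace (𝓡 n) x),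
        Hypersurface.weyl (Hypersurface.riemannLog (𝓡 n) x) a b c d = 0) →
      Hypersurface.IsSmoothSymmetric (𝓡 n) (Hypersurface.expSchoutenLog (𝓡 n) : (x : M) → _) ∧
        Hypersurface.Gauss (𝓡 n) (Hypersurface.expSchoutenLog (𝓡 n) : (x : M) → _) ∧
        Hypersurface.Codazzi (𝓡 n) (Hypersurface.expSchoutenLog (𝓡 n) : (x : M) → _)) ∧
    (∀ h : (x : M) → TangentSpace (𝓡 n) x →L[ℝ] TangentSpace (𝓡 n) x →L[ℝ] ℝ,
      Hypersurface.IsSmoothSymmetric (𝓡 n) h → Hypersurface.Gauss (𝓡 n) h →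
        Hypersurface.Codazzi (𝓡 n) h) := by
  have hn3 : 3 < finrank ℝ (EuclideanSpace ℝ (Fin n)) := by simpa using hn
  refine ⟨fun hcurv hw ↦ ?_, fun h hh hG ↦ hG.codazzi hn3 hsec hh⟩
  have hG : Hypersurface.Gauss (𝓡 n) (Hypersurface.expSchoutenLog (𝓡 n) : (x : M) → _) :=
    Hypersurface.gauss_expSchoutenLog hcurv hw
  have sm : Hypersurface.IsSmoothSymmetric (𝓡 n)
      (Hypersurface.expSchoutenLog (𝓡 n) : (x : M) → _) :=
    hG.isSmoothSymmetric (by omega) hsec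
      (fun x u v ↦ Hypersurface.expForm_symm (Hypersurface.logTensor_pair_symm _) u v)
      (fun x u hu ↦ Hypersurface.expForm_pos (Hypersurface.logTensor_pair_symm _) hu)
  exact ⟨sm, hG, hG.codazzi hn3 hsec sm⟩
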